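/- Let $\mathbf{O}$ be the real octonions, with conjugation $x\mapsto\overline{x}$, inner product $(x|y)=\mathrm{Re}(x\overline{y})$ and standard units $1=e_0,e_1,\dots,e_7$, and let $\mathrm{Im}\,\mathbf{O}=\mathrm{span}_{\mathbb{R}}(e_1,\dots,e_7)$. For $\xi_i\in\mathbb{R}$ and $x_i\in\mathbf{O}$ put $$h^1(\xi_1,\xi_2,\xi_3;x_1,x_2,x_3)=\begin{pmatrix}\xi_1&\sqrt{-1}\,x_3&\sqrt{-1}\,\overline{x_2}\\ \sqrt{-1}\,\overline{x_3}&\xi_2&x_1\\ \sqrt{-1}\,x_2&\overline{x_1}&\xi_3\end{pmatrix}$$ (entries in $\mathbf{O}\otimes\mathbb{C}$), and let $\mathcal{J}^1$ be the real vector space of all these matrices, with the Jordan product $X\circ Y=\frac12(XY+YX)$, the trace $\mathrm{tr}(X)=\xi_1+\xi_2+\xi_3$ and the inner product $(X|Y)=\mathrm{tr}(X\circ Y)$. Let $$\mathrm{F}_{4(-20)}=\{g\in\mathrm{GL}_{\mathbb{R}}(\mathcal{J}^1)\mid g(X\circ Y)=gX\circ gY\text{ for all }X,Y\},$$ and let $\mathfrak{f}_{4(-20)}$,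 its Lie algebra, be the space of derivations of $\mathcal{J}^1$. Put $E_1=h^1(1,0,0;0,0,0)$, $F_3^1(x)=h^1(0,0,0;0,0,x)$, $P^-=h^1(-1,1,0;0,0,1)$ and $Q^+(x)=h^1(0,0,0;x,\overline{x},0)$. Let $\sigma h^1(\xi_1,\xi_2,\xi_3;x_1,x_2,x_3)=h^1(\xi_1,\xi_2,\xi_3;x_1,-x_2,-x_3)$ and $K=\{g\in\mathrm{F}_{4(-20)}\mid\sigma g\sigma^{-1}=g\}$. For $a\in\mathbf{O}$ let $\tilde{A}_i^1(a)$ be the derivation $X\mapsto A_i^1(a)X-XA_i^1(a)$ of $\mathcal{J}^1$, where $$A_1^1(a)=\begin{pmatrix}0&0&0\\0&0&a\\0&-\overline{a}&0\end{pmatrix},\quad A_2^1(a)=\sqrt{-1}\begin{pmatrix}0&0&-\overline{a}\\0&0&0\\a&0&0\end{pmatrix},\quad A_3^1(a)=\sqrt{-1}\begin{pmatrix}0&a&0\\-\overline{a}&0&0\\0&0&0\end{pmatrix}.$$ For $p\in\mathrm{Im}\,\mathbf{O}$ let $\delta(p)h^1(\xi_1,\xi_2,\xi_3;x_1,x_2,x_3)=h^1(0,0,0;px_1,x_2p,-(px_3+x_3p))$.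 Put $\mathcal{G}_1(x)=\tilde{A}_1^1(x)+\tilde{A}_2^1(-\overline{x})$ for $x\in\mathbf{O}$ and $\mathcal{G}_2(p)=\tilde{A}_3^1(-p)-\delta(p)$ for $p\in\mathrm{Im}\,\mathbf{O}$. Let $\mathfrak{a}=\mathbb{R}\tilde{A}_3^1(1)$, let $\alpha$ be the linear form on $\mathfrak{a}$ with $\alpha(\tilde{A}_3^1(1))=1$, let $\mathfrak{g}_{\lambda}=\{D\in\mathfrak{f}_{4(-20)}\mid[H,D]=\lambda(H)D\text{ for all }H\in\mathfrak{a}\}$, and let $\mathfrak{n}^+=\mathfrak{g}_{\alpha}+\mathfrak{g}_{2\alpha}$ and $N^+=\exp\mathfrak{n}^+$. **Theorem (explicit Iwasawa decomposition of $\mathrm{F}_{4(-20)}$).** $K$ is the stabilizer of $E_1$ in $\mathrm{F}_{4(-20)}$. For every $g\in\mathrm{F}_{4(-20)}$ there exist unique $k(g)\in K$, $H(g)\in\mathfrak{a}$ and $n_I(g)\in N^+$ such that $$g=k(g)\,\exp(H(g))\,n_I(g).$$ Moreover $(gP^-|E_1)<0$, and these elements are given by $$H(g)=\tfrac12\log\bigl(-(gP^-|E_1)\bigr)\,\tilde{A}_3^1(1),$$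 $$n_I(g)=\exp\left(\mathcal{G}_1\left(\frac{\sum_{i=0}^7(gQ^+(e_i)|E_1)\,e_i}{2\,(gP^-|E_1)}\right)+\mathcal{G}_2\left(-\frac{\sum_{i=1}^7(gF_3^1(e_i)|E_1)\,e_i}{2\,(gP^-|E_1)}\right)\right),$$ $$k(g)=g\,n_I(g)^{-1}\exp(-H(g)).$$ -/

import Mathlib

open scoped Quaternion

noncomputable section

set_option linter.unusedSimpArgs false

namespace F4Iwasawa

/-! ### Octonions -/

/-- The octonion algebra with coefficients in `R`, as the Cayley–Dickson double of the
quaternions. `Octonion ℝ` is the algebra `𝐎` of octonions, `Octonion ℂ` its complexification. -/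
def Octonion (R : Type) [CommRing R] : Type := ℍ[R] × ℍ[R]

namespace Octonion

instance (R : Type) [CommRing R] : AddCommGroup (Octonion R) :=
  inferInstanceAs (AddCommGroup (ℍ[R] × ℍ[R]))

instance (R : Type) [CommRing R] : Module R (Octonion R) :=
  inferInstanceAs (Module R (ℍ[R] × ℍ[R]))

instance (R : Type) [CommRing R] : Module.Finite R (Octonion R) :=
  inferInstanceAs (Module.Finite R (ℍ[R] × ℍ[R]))

/-- Only the topology given by this norm is used (through the exponential series). -/
instance : NormedAddCommGroup (Octonion ℝ) :=
  inferInstanceAs (NormedAddCommGroup (ℍ[ℝ] × ℍ[ℝ]))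

instance : NormedSpace ℝ (Octonion ℝ) :=
  inferInstanceAs (NormedSpace ℝ (ℍ[ℝ] × ℍ[ℝ]))

variable {R : Type} [CommRing R]

/-- The octonion `a + b ℓ` with quaternions `a`, `b`. -/
def mk (a b : ℍ[R]) : Octonion R := (a, b)

/-- The first quaternion component. -/
def fst (x : Octonion R) : ℍ[R] := Prod.fst x

/-- The second quaternion component. -/
def snd (x : Octonion R) : ℍ[R] := Prod.snd x

/-- The quaternion `a + b i + c j + d k`. -/
def quat (a b c d : R) : ℍ[R] := (Quaternion.equivTuple R).symm ![a, b, c, d]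

@[simp] theorem quat_re (a b c d : R) : (quat a b c d).re = a := rfl
@[simp] theorem quat_imI (a b c d : R) : (quat a b c d).imI = b := rfl
@[simp] theorem quat_imJ (a b c d : R) : (quat a b c d).imJ = c := rfl
@[simp] theorem quat_imK (a b c d : R) : (quat a b c d).imK = d := rfl

instance : One (Octonion R) := ⟨mk 1 0⟩

/-- `(a, b) (c, d) = (a c - d̄ b, d a + b c̄)`. -/
instance : Mul (Octonion R) :=
  ⟨fun x y => mk (x.fst * y.fst - star y.snd * x.snd) (y.snd * x.fst + x.snd * star y.fst)⟩

/-- The conjugation `x ↦ x̄` (`R`-linear). -/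
def conj (x : Octonion R) : Octonion R := mk (star x.fst) (-x.snd)

/-- The real part. -/
def re (x : Octonion R) : R := x.fst.re

/-- The inner product `(x|y) = Re (x ȳ)`. -/
def ip (x y : Octonion R) : R := (x * conj y).re

/-- The units `1 = e₀, e₁, …, e₇`. -/
def e (i : Fin 8) : Octonion ℝ :=
  ![mk (quat 1 0 0 0) 0, mk (quat 0 1 0 0) 0, mk (quat 0 0 1 0) 0, mk (quat 0 0 0 1) 0,
    mk 0 (quat 1 0 0 0), mk 0 (quat 0 1 0 0), mk 0 (quat 0 0 1 0), mk 0 (quat 0 0 0 1)] i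

/-- The inclusion of the octonions in the complex octonions. -/
def toComplex (x : Octonion ℝ) : Octonion ℂ :=
  mk (quat x.fst.re x.fst.imI x.fst.imJ x.fst.imK) (quat x.snd.re x.snd.imI x.snd.imJ x.snd.imK)

@[ext] theorem ext {x y : Octonion R} (h1 : x.fst = y.fst) (h2 : x.snd = y.snd) : x = y :=
  Prod.ext h1 h2

@[simp] theorem fst_mk (a b : ℍ[R]) : (mk a b).fst = a := rfl
@[simp] theorem snd_mk (a b : ℍ[R]) : (mk a b).snd = b := rfl
@[simp] theorem fst_zero : (0 : Octonion R).fst = 0 := rfl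
@[simp] theorem snd_zero : (0 : Octonion R).snd = 0 := rfl
@[simp] theorem fst_one : (1 : Octonion R).fst = 1 := rfl
@[simp] theorem snd_one : (1 : Octonion R).snd = 0 := rfl
@[simp] theorem fst_add (x y : Octonion R) : (x + y).fst = x.fst + y.fst := rfl
@[simp] theorem snd_add (x y : Octonion R) : (x + y).snd = x.snd + y.snd := rfl
@[simp] theorem fst_sub (x y : Octonion R) : (x - y).fst = x.fst - y.fst := rfl
@[simp] theorem snd_sub (x y : Octonion R) : (x - y).snd = x.snd - y.snd := rfl
@[simp] theorem fst_neg (x : Octonion R) : (-x).fst = -x.fst := rfl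
@[simp] theorem snd_neg (x : Octonion R) : (-x).snd = -x.snd := rfl
@[simp] theorem fst_smul (r : R) (x : Octonion R) : (r • x).fst = r • x.fst := rfl
@[simp] theorem snd_smul (r : R) (x : Octonion R) : (r • x).snd = r • x.snd := rfl
@[simp] theorem fst_mul (x y : Octonion R) :
    (x * y).fst = x.fst * y.fst - star y.snd * x.snd := rfl
@[simp] theorem snd_mul (x y : Octonion R) :
    (x * y).snd = y.snd * x.fst + x.snd * star y.fst := rfl

theorem mul_add' (x y z : Octonion R) : x * (y + z) = x * y + x * z := by
  ext1 <;> simp [mul_add, add_mul] <;> abel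

theorem add_mul' (x y z : Octonion R) : (x + y) * z = x * z + y * z := by
  ext1 <;> simp [mul_add, add_mul] <;> abel

instance : NonUnitalNonAssocRing (Octonion R) where
  left_distrib := mul_add'
  right_distrib := add_mul'
  zero_mul x := by ext1 <;> simp
  mul_zero x := by ext1 <;> simp

theorem mul_smul_right' (r : R) (x y : Octonion R) : x * (r • y) = r • (x * y) := by
  ext1 <;> simp [smul_sub]

theorem smul_mul_left' (r : R) (x y : Octonion R) : (r • x) * y = r • (x * y) := by
  ext1 <;> simp [smul_sub]

theorem conj_add (x y : Octonion R) : conj (x + y) = conj x + conj y := by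
  ext1 <;> simp [conj]; abel

theorem conj_smul (r : R) (x : Octonion R) : conj (r • x) = r • conj x := by
  ext1 <;> simp [conj]

theorem ip_add (a x y : Octonion R) : ip a (x + y) = ip a x + ip a y := by
  simp [ip, conj_add, mul_add', re]

theorem add_ip (x y a : Octonion R) : ip (x + y) a = ip x a + ip y a := by
  simp [ip, add_mul', re]

theorem smul_ip (r : R) (x a : Octonion R) : ip (r • x) a = r * ip x a := by
  simp [ip, smul_mul_left', re]
  try ring

theorem ip_smul (r : R) (a x : Octonion R) : ip a (r • x) = r * ip a x := by
  simp [ip, conj_smul, mul_smul_right', re]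
  try ring

end Octonion

/-! ### The exceptional Jordan algebra `𝒥¹` -/

/-- The space `𝒥¹`: `(ξ, x)` stands for the matrix `h¹(ξ₁, ξ₂, ξ₃; x₁, x₂, x₃)`, see
`J1.toMatrix`. The indices `1, 2, 3` are the elements `0, 1, 2` of `Fin 3`. -/
abbrev J1 : Type := (Fin 3 → ℝ) × (Fin 3 → Octonion ℝ)

open Octonion

/-- The element `h¹(ξ₁, ξ₂, ξ₃; x₁, x₂, x₃)`. -/
def h1 (ξ₁ ξ₂ ξ₃ : ℝ) (x₁ x₂ x₃ : Octonion ℝ) : J1 := (![ξ₁, ξ₂, ξ₃], ![x₁, x₂, x₃])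

/-- A real number, as a complex octonion. -/
def realC (r : ℝ) : Octonion ℂ := toComplex (r • 1)

/-- `√-1 x` for an octonion `x`. -/
def iC (x : Octonion ℝ) : Octonion ℂ := Complex.I • toComplex x

/-- The matrix with entries in the complex octonions that an element of `𝒥¹` stands for. -/
def J1.toMatrix (X : J1) : Matrix (Fin 3) (Fin 3) (Octonion ℂ) :=
  !![realC (X.1 0), iC (X.2 2), iC (conj (X.2 1));
     iC (conj (X.2 2)), realC (X.1 1), toComplex (X.2 0);
     iC (X.2 1), toComplex (conj (X.2 0)), realC (X.1 2)]

/-- The Jordan product `X ∘ Y = ½ (X Y + Y X)`, in coordinates (see `toMatrix_jmul`). -/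
def jmul (X Y : J1) : J1 :=
  h1 (X.1 0 * Y.1 0 - ip (X.2 1) (Y.2 1) - ip (X.2 2) (Y.2 2))
    (X.1 1 * Y.1 1 + ip (X.2 0) (Y.2 0) - ip (X.2 2) (Y.2 2))
    (X.1 2 * Y.1 2 + ip (X.2 0) (Y.2 0) - ip (X.2 1) (Y.2 1))
    ((1 / 2 : ℝ) • ((X.1 1 + X.1 2) • Y.2 0 + (Y.1 1 + Y.1 2) • X.2 0
      - conj (X.2 1 * Y.2 2) - conj (Y.2 1 * X.2 2)))
    ((1 / 2 : ℝ) • ((X.1 2 + X.1 0) • Y.2 1 + (Y.1 2 + Y.1 0) • X.2 1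
      + conj (X.2 2 * Y.2 0) + conj (Y.2 2 * X.2 0)))
    ((1 / 2 : ℝ) • ((X.1 0 + X.1 1) • Y.2 2 + (Y.1 0 + Y.1 1) • X.2 2
      + conj (X.2 0 * Y.2 1) + conj (Y.2 0 * X.2 1)))


theorem toComplex_mul (x y : Octonion ℝ) : toComplex x * toComplex y = toComplex (x * y) := by
  ext <;> simp [toComplex]

theorem toComplex_mul_iC (x y : Octonion ℝ) : toComplex x * iC y = iC (x * y) := by
  rw [iC, mul_smul_right', toComplex_mul, iC]

theorem iC_mul_toComplex (x y : Octonion ℝ) : iC x * toComplex y = iC (x * y) := by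
  rw [iC, smul_mul_left', toComplex_mul, iC]

theorem iC_mul_iC (x y : Octonion ℝ) : iC x * iC y = toComplex (-(x * y)) := by
  rw [iC, iC, smul_mul_left', mul_smul_right', toComplex_mul, smul_smul, Complex.I_mul_I]
  ext <;> simp [toComplex]

theorem toComplex_add (x y : Octonion ℝ) : toComplex x + toComplex y = toComplex (x + y) := by
  ext <;> simp [toComplex]

theorem iC_add (x y : Octonion ℝ) : iC x + iC y = iC (x + y) := by
  rw [iC, iC, ← smul_add, toComplex_add, iC]

theorem neg_toComplex (x : Octonion ℝ) : -toComplex x = toComplex (-x) := by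
  ext <;> simp [toComplex]

theorem neg_iC (x : Octonion ℝ) : -iC x = iC (-x) := by
  rw [iC, iC, ← neg_toComplex, smul_neg]

theorem toComplex_sub (x y : Octonion ℝ) : toComplex x - toComplex y = toComplex (x - y) := by
  ext <;> simp [toComplex]

theorem iC_sub (x y : Octonion ℝ) : iC x - iC y = iC (x - y) := by
  rw [iC, iC, ← smul_sub, toComplex_sub, iC]

theorem toComplex_zero : toComplex 0 = 0 := by
  ext <;> simp [toComplex]

theorem iC_zero : iC 0 = 0 := by
  rw [iC, toComplex_zero, smul_zero]

theorem half_toComplex (x : Octonion ℝ) :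
    (1 / 2 : ℂ) • toComplex x = toComplex ((1 / 2 : ℝ) • x) := by
  ext <;> simp [toComplex]

theorem half_iC (x : Octonion ℝ) : (1 / 2 : ℂ) • iC x = iC ((1 / 2 : ℝ) • x) := by
  rw [iC, smul_comm, half_toComplex, iC]

theorem mul_conj_add (x y : Octonion ℝ) : x * conj y + y * conj x = (2 * ip x y) • 1 := by
  ext <;> simp [conj, ip, Octonion.re] <;> ring

theorem conj_mul_add (x y : Octonion ℝ) : conj x * y + conj y * x = (2 * ip x y) • 1 := by
  ext <;> simp [conj, ip, Octonion.re] <;> ring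

theorem conj_mul (x y : Octonion ℝ) : conj (x * y) = conj y * conj x := by
  ext1 <;> simp [conj]

theorem conj_conj (x : Octonion ℝ) : conj (conj x) = x := by
  ext <;> simp [conj]

theorem conj_neg (x : Octonion ℝ) : conj (-x) = -conj x := by
  ext <;> simp [conj]

theorem conj_sub (x y : Octonion ℝ) : conj (x - y) = conj x - conj y := by
  rw [sub_eq_add_neg, conj_add, conj_neg, ← sub_eq_add_neg]

theorem mul_real (r : ℝ) (x : Octonion ℝ) : x * (r • 1) = r • x := by
  ext <;> simp

theorem real_mul (r : ℝ) (x : Octonion ℝ) : (r • 1) * x = r • x := by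
  ext <;> simp

/-- The Jordan product of `𝒥¹` is `½ (X Y + Y X)`, for the product of matrices. -/
theorem toMatrix_jmul (X Y : J1) :
    (jmul X Y).toMatrix = (1 / 2 : ℂ) • (X.toMatrix * Y.toMatrix + Y.toMatrix * X.toMatrix) := by
  obtain ⟨ξ, x⟩ := X
  obtain ⟨η, y⟩ := Y
  have l := fun i => mul_conj_add (x i) (y i)
  have r := fun i => conj_mul_add (x i) (y i)
  ext i j : 1
  simp only [Matrix.smul_apply, Matrix.add_apply, Matrix.mul_apply, Fin.sum_univ_three]
  fin_cases i <;> fin_cases j <;>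
    simp only [J1.toMatrix, jmul, h1, realC, Matrix.of_apply, Matrix.cons_val, Fin.zero_eta,
      Fin.mk_one, Fin.reduceFinMk, toComplex_mul, toComplex_mul_iC, iC_mul_toComplex, iC_mul_iC,
      toComplex_add, iC_add, half_toComplex, half_iC] <;>
    congr 1 <;> simp only [mul_real, real_mul, conj_mul, conj_conj, conj_smul, conj_add, conj_sub]
  · linear_combination (norm := module) (1 / 2 : ℝ) • l 2 + (1 / 2 : ℝ) • r 1
  · module
  · module
  · module
  · linear_combination (norm := module) (1 / 2 : ℝ) • r 2 - (1 / 2 : ℝ) • l 0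
  · module
  · module
  · module
  · linear_combination (norm := module) (1 / 2 : ℝ) • l 1 - (1 / 2 : ℝ) • r 0

theorem add_jmul (X X' Y : J1) : jmul (X + X') Y = jmul X Y + jmul X' Y := by
  ext i : 2 <;> fin_cases i <;>
    simp [jmul, h1, ip_add, add_ip, conj_add, mul_add, add_mul] <;> first
    | ring1
    | module

theorem jmul_add (X Y Y' : J1) : jmul X (Y + Y') = jmul X Y + jmul X Y' := by
  ext i : 2 <;> fin_cases i <;>
    simp [jmul, h1, ip_add, add_ip, conj_add, mul_add, add_mul] <;> first
    | ring1
    | module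

theorem smul_jmul (r : ℝ) (X Y : J1) : jmul (r • X) Y = r • jmul X Y := by
  ext i : 2 <;> fin_cases i <;>
    simp [jmul, h1, ip_smul, smul_ip, conj_smul, mul_smul_right', smul_mul_left'] <;> first
    | ring1
    | module

theorem jmul_smul (r : ℝ) (X Y : J1) : jmul X (r • Y) = r • jmul X Y := by
  ext i : 2 <;> fin_cases i <;>
    simp [jmul, h1, ip_smul, smul_ip, conj_smul, mul_smul_right', smul_mul_left'] <;> first
    | ring1
    | module

/-- The trace. -/
def tr (X : J1) : ℝ := X.1 0 + X.1 1 + X.1 2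

/-- The inner product `(X|Y) = tr (X ∘ Y)`. -/
def jip (X Y : J1) : ℝ := tr (jmul X Y)

/-- The idempotent `E₁`. -/
def E₁ : J1 := h1 1 0 0 0 0 0

/-- `F₃¹(x)`. -/
def F₃ (x : Octonion ℝ) : J1 := h1 0 0 0 0 0 x

/-- `P⁻ = h¹(-1, 1, 0; 0, 0, 1)`. -/
def Pminus : J1 := h1 (-1) 1 0 0 0 1

/-- `Q⁺(x) = h¹(0, 0, 0; x, x̄, 0)`. -/
def Qplus (x : Octonion ℝ) : J1 := h1 0 0 0 x (conj x) 0

/-! ### The group `F₄₍₋₂₀₎` and the subgroup `K` -/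

/-- `GL_ℝ(𝒥¹)`. -/
abbrev GLJ : Type := LinearMap.GeneralLinearGroup ℝ J1

/-- The group `F₄₍₋₂₀₎` of automorphisms of the Jordan algebra `𝒥¹`. -/
def F4 : Subgroup GLJ where
  carrier := {g | ∀ X Y : J1, g.val (jmul X Y) = jmul (g.val X) (g.val Y)}
  one_mem' := fun _ _ => rfl
  mul_mem' := by
    intro g h hg hh X Y
    change g.val (h.val (jmul X Y)) = jmul (g.val (h.val X)) (g.val (h.val Y))
    rw [hh, hg]
  inv_mem' := by
    intro g hg X Y
    have key : ∀ Z : J1, g.inv (g.val Z) = Z := fun Z => LinearMap.congr_fun g.inv_val Z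
    have key' : ∀ Z : J1, g.val (g.inv Z) = Z := fun Z => LinearMap.congr_fun g.val_inv Z
    change g.inv (jmul X Y) = jmul (g.inv X) (g.inv Y)
    rw [← key (jmul (g.inv X) (g.inv Y)), hg, key', key']

/-- `σ = σ₁`, as a linear map: it changes the signs of `x₂` and `x₃`. -/
def sigmaLin : Module.End ℝ J1 where
  toFun X := h1 (X.1 0) (X.1 1) (X.1 2) (X.2 0) (-X.2 1) (-X.2 2)
  map_add' X Y := by
    ext i : 2 <;> fin_cases i <;> simp [h1, add_comm]
  map_smul' r X := by
    ext i : 2 <;> fin_cases i <;> simp [h1]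

theorem sigmaLin_mul_self : sigmaLin * sigmaLin = 1 := by
  refine LinearMap.ext fun X => ?_
  ext i : 2 <;> fin_cases i <;> simp [sigmaLin, h1]

/-- The involution `σ = σ₁`. -/
def sigma : GLJ := ⟨sigmaLin, sigmaLin, sigmaLin_mul_self, sigmaLin_mul_self⟩

/-- `K`, the group of fixed points in `F₄₍₋₂₀₎` of the Cartan involution `g ↦ σ g σ⁻¹`. -/
def K : Subgroup GLJ where
  carrier := {g | g ∈ F4 ∧ sigma * g * sigma⁻¹ = g}
  one_mem' := ⟨one_mem _, by simp⟩
  mul_mem' := by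
    rintro g h ⟨hg, hg'⟩ ⟨hh, hh'⟩
    refine ⟨mul_mem hg hh, ?_⟩
    calc sigma * (g * h) * sigma⁻¹ = (sigma * g * sigma⁻¹) * (sigma * h * sigma⁻¹) := by group
      _ = g * h := by rw [hg', hh']
  inv_mem' := by
    rintro g ⟨hg, hg'⟩
    refine ⟨inv_mem hg, ?_⟩
    calc sigma * g⁻¹ * sigma⁻¹ = (sigma * g * sigma⁻¹)⁻¹ := by group
      _ = g⁻¹ := by rw [hg']

/-! ### The Lie algebra `𝔣₄₍₋₂₀₎` and the subspaces `𝔞` and `𝔫⁺` -/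

/-- The Lie algebra of `F₄₍₋₂₀₎`: the derivations of the Jordan algebra `𝒥¹`. -/
def f4 : Submodule ℝ (Module.End ℝ J1) where
  carrier := {D | ∀ X Y : J1, D (jmul X Y) = jmul (D X) Y + jmul X (D Y)}
  zero_mem' := by
    intro X Y
    have h₁ : jmul 0 Y = 0 := by simpa using smul_jmul 0 0 Y
    have h₂ : jmul X 0 = 0 := by simpa using jmul_smul 0 X 0
    simp [h₁, h₂]
  add_mem' := by
    intro D D' hD hD' X Y
    rw [LinearMap.add_apply, hD, hD', LinearMap.add_apply, LinearMap.add_apply, jmul_add,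
      add_jmul]
    abel
  smul_mem' := by
    intro r D hD X Y
    rw [LinearMap.smul_apply, hD, LinearMap.smul_apply, LinearMap.smul_apply, jmul_smul,
      smul_jmul, smul_add]

/-- The matrix `A₁¹(a)`. -/
def matA₁ (a : Octonion ℝ) : Matrix (Fin 3) (Fin 3) (Octonion ℂ) :=
  !![0, 0, 0; 0, 0, toComplex a; 0, -toComplex (conj a), 0]

/-- The matrix `A₂¹(a)`. -/
def matA₂ (a : Octonion ℝ) : Matrix (Fin 3) (Fin 3) (Octonion ℂ) :=
  !![0, 0, -iC (conj a); 0, 0, 0; iC a, 0, 0]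

/-- The matrix `A₃¹(a)`. -/
def matA₃ (a : Octonion ℝ) : Matrix (Fin 3) (Fin 3) (Octonion ℂ) :=
  !![0, iC a, 0; -iC (conj a), 0, 0; 0, 0, 0]

/-- The derivation `Ã₁¹(a) : X ↦ A₁¹(a) X - X A₁¹(a)`, in coordinates (see `toMatrix_At₁`). -/
def At₁ (a : Octonion ℝ) : Module.End ℝ J1 where
  toFun X := h1 0 (2 * ip a (X.2 0)) (-(2 * ip a (X.2 0)))
    ((X.1 2 - X.1 1) • a) (-conj (X.2 2 * a)) (conj (a * X.2 1))
  map_add' X Y := by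
    ext i : 2 <;> fin_cases i <;> simp [h1, ip_add, conj_add, mul_add, add_mul] <;> first
      | ring1
      | module
  map_smul' r X := by
    ext i : 2 <;> fin_cases i <;>
      simp [h1, ip_smul, conj_smul, mul_smul_right', smul_mul_left'] <;> first
      | ring1
      | module

/-- The derivation `Ã₂¹(a) : X ↦ A₂¹(a) X - X A₂¹(a)`, in coordinates (see `toMatrix_At₂`). -/
def At₂ (a : Octonion ℝ) : Module.End ℝ J1 where
  toFun X := h1 (2 * ip a (X.2 1)) 0 (-(2 * ip a (X.2 1)))
    (-conj (a * X.2 2)) ((X.1 0 - X.1 2) • a) (-conj (X.2 0 * a))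
  map_add' X Y := by
    ext i : 2 <;> fin_cases i <;> simp [h1, ip_add, conj_add, mul_add, add_mul] <;> first
      | ring1
      | module
  map_smul' r X := by
    ext i : 2 <;> fin_cases i <;>
      simp [h1, ip_smul, conj_smul, mul_smul_right', smul_mul_left'] <;> first
      | ring1
      | module

/-- The derivation `Ã₃¹(a) : X ↦ A₃¹(a) X - X A₃¹(a)`, in coordinates (see `toMatrix_At₃`). -/
def At₃ (a : Octonion ℝ) : Module.End ℝ J1 where
  toFun X := h1 (-(2 * ip a (X.2 2))) (2 * ip a (X.2 2)) 0
    (conj (X.2 1 * a)) (conj (a * X.2 0)) ((X.1 1 - X.1 0) • a)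
  map_add' X Y := by
    ext i : 2 <;> fin_cases i <;> simp [h1, ip_add, conj_add, mul_add, add_mul] <;> first
      | ring1
      | module
  map_smul' r X := by
    ext i : 2 <;> fin_cases i <;>
      simp [h1, ip_smul, conj_smul, mul_smul_right', smul_mul_left'] <;> first
      | ring1
      | module

theorem toMatrix_At₁ (a : Octonion ℝ) (X : J1) :
    (At₁ a X).toMatrix = matA₁ a * X.toMatrix - X.toMatrix * matA₁ a := by
  obtain ⟨ξ, x⟩ := X
  have l := fun i => mul_conj_add a (x i)
  have r := fun i => conj_mul_add a (x i)
  ext i j : 1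
  simp only [Matrix.sub_apply, Matrix.mul_apply, Fin.sum_univ_three]
  fin_cases i <;> fin_cases j <;>
    simp only [J1.toMatrix, matA₁, At₁, LinearMap.coe_mk, AddHom.coe_mk, h1, realC,
      Matrix.of_apply, Matrix.cons_val, Fin.zero_eta, Fin.mk_one, Fin.reduceFinMk, zero_mul,
      mul_zero, zero_add, add_zero, sub_zero, sub_self, neg_toComplex, neg_iC, zero_sub,
      toComplex_mul, toComplex_mul_iC, iC_mul_toComplex, iC_mul_iC,
      toComplex_add, iC_add, toComplex_sub, iC_sub, zero_smul, toComplex_zero, iC_zero] <;>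
    try (congr 1; simp only [mul_real, real_mul, conj_mul, conj_conj, conj_smul, conj_neg,
      neg_mul, mul_neg])
  all_goals first
    | module
    | linear_combination (norm := module) -l 0
    | linear_combination (norm := module) r 0

theorem toMatrix_At₂ (a : Octonion ℝ) (X : J1) :
    (At₂ a X).toMatrix = matA₂ a * X.toMatrix - X.toMatrix * matA₂ a := by
  obtain ⟨ξ, x⟩ := X
  have l := fun i => mul_conj_add a (x i)
  have r := fun i => conj_mul_add a (x i)
  ext i j : 1
  simp only [Matrix.sub_apply, Matrix.mul_apply, Fin.sum_univ_three]
  fin_cases i <;> fin_cases j <;>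
    simp only [J1.toMatrix, matA₂, At₂, LinearMap.coe_mk, AddHom.coe_mk, h1, realC,
      Matrix.of_apply, Matrix.cons_val, Fin.zero_eta, Fin.mk_one, Fin.reduceFinMk, zero_mul,
      mul_zero, zero_add, add_zero, sub_zero, sub_self, neg_toComplex, neg_iC, zero_sub,
      toComplex_mul, toComplex_mul_iC, iC_mul_toComplex, iC_mul_iC,
      toComplex_add, iC_add, toComplex_sub, iC_sub, zero_smul, toComplex_zero, iC_zero] <;>
    try (congr 1; simp only [mul_real, real_mul, conj_mul, conj_conj, conj_smul, conj_neg,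
      neg_mul, mul_neg])
  all_goals first
    | module
    | linear_combination (norm := module) -r 1
    | linear_combination (norm := module) l 1

theorem toMatrix_At₃ (a : Octonion ℝ) (X : J1) :
    (At₃ a X).toMatrix = matA₃ a * X.toMatrix - X.toMatrix * matA₃ a := by
  obtain ⟨ξ, x⟩ := X
  have l := fun i => mul_conj_add a (x i)
  have r := fun i => conj_mul_add a (x i)
  ext i j : 1
  simp only [Matrix.sub_apply, Matrix.mul_apply, Fin.sum_univ_three]
  fin_cases i <;> fin_cases j <;>
    simp only [J1.toMatrix, matA₃, At₃, LinearMap.coe_mk, AddHom.coe_mk, h1, realC,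
      Matrix.of_apply, Matrix.cons_val, Fin.zero_eta, Fin.mk_one, Fin.reduceFinMk, zero_mul,
      mul_zero, zero_add, add_zero, sub_zero, sub_self, neg_toComplex, neg_iC, zero_sub,
      toComplex_mul, toComplex_mul_iC, iC_mul_toComplex, iC_mul_iC,
      toComplex_add, iC_add, toComplex_sub, iC_sub, zero_smul, toComplex_zero, iC_zero] <;>
    try (congr 1; simp only [mul_real, real_mul, conj_mul, conj_conj, conj_smul, conj_neg,
      neg_mul, mul_neg])
  all_goals first
    | module
    | linear_combination (norm := module) l 2
    | linear_combination (norm := module) -r 2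

/-- `δ(p)`, used for imaginary `p`: it annihilates `E₁, E₂, E₃` and acts on the octonion
coordinates by `x₁ ↦ p x₁`, `x₂ ↦ x₂ p`, `x₃ ↦ -(p x₃ + x₃ p)`. -/
def delta (p : Octonion ℝ) : Module.End ℝ J1 where
  toFun X := h1 0 0 0 (p * X.2 0) (X.2 1 * p) (-(p * X.2 2 + X.2 2 * p))
  map_add' X Y := by
    ext i : 2 <;> fin_cases i <;> simp [h1, mul_add, add_mul] <;> module
  map_smul' r X := by
    ext i : 2 <;> fin_cases i <;> simp [h1, mul_smul_right', smul_mul_left', smul_add]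

/-- `𝒢₁(x) = Ã₁¹(x) + Ã₂¹(-x̄)`. -/
def G₁ (x : Octonion ℝ) : Module.End ℝ J1 := At₁ x + At₂ (-conj x)

/-- `𝒢₂(p) = Ã₃¹(-p) - δ(p)`. -/
def G₂ (p : Octonion ℝ) : Module.End ℝ J1 := At₃ (-p) - delta p

/-- `𝔞 = ℝ Ã₃¹(1)`. -/
def frakA : Submodule ℝ (Module.End ℝ J1) := Submodule.span ℝ {At₃ 1}

/-- The root space `𝔤_{cα}`, where `α` is the linear form on `𝔞` with `α(Ã₃¹(1)) = 1`. -/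
def rootSpace (c : ℝ) : Submodule ℝ (Module.End ℝ J1) where
  carrier := {D | D ∈ f4 ∧ ∀ t : ℝ, (t • At₃ 1) * D - D * (t • At₃ 1) = (c * t) • D}
  zero_mem' := ⟨zero_mem _, by simp⟩
  add_mem' := by
    rintro D D' ⟨hD, h⟩ ⟨hD', h'⟩
    exact ⟨add_mem hD hD', fun t => by
      rw [smul_add, ← h, ← h', mul_add, add_mul]
      abel⟩
  smul_mem' := by
    rintro r D ⟨hD, h⟩
    exact ⟨Submodule.smul_mem _ r hD, fun t => by
      rw [smul_comm, ← h, mul_smul_comm, smul_mul_assoc r D, smul_sub]⟩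

/-- `𝔫⁺ = 𝔤_α + 𝔤_{2α}`. -/
def frakN : Submodule ℝ (Module.End ℝ J1) := rootSpace 1 ⊔ rootSpace 2

/-! ### The exponential map and the explicit factors -/

theorem exp_mul_exp_neg (T : J1 →L[ℝ] J1) : NormedSpace.exp T * NormedSpace.exp (-T) = 1 := by
  let _ : NormedAlgebra ℚ (J1 →L[ℝ] J1) := NormedAlgebra.restrictScalars ℚ ℝ _
  rw [← NormedSpace.exp_add_of_commute (Commute.neg_right (Commute.refl T)), add_neg_cancel,
    NormedSpace.exp_zero]

theorem exp_neg_mul_exp (T : J1 →L[ℝ] J1) : NormedSpace.exp (-T) * NormedSpace.exp T = 1 := by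
  have h := exp_mul_exp_neg (-T)
  rwa [neg_neg] at h

/-- The exponential map `End_ℝ(𝒥¹) → GL_ℝ(𝒥¹)`. -/
def expGL (D : Module.End ℝ J1) : GLJ where
  val := (NormedSpace.exp (LinearMap.toContinuousLinearMap D) : J1 →L[ℝ] J1)
  inv := (NormedSpace.exp (-LinearMap.toContinuousLinearMap D) : J1 →L[ℝ] J1)
  val_inv := congrArg ContinuousLinearMap.toLinearMap
    (exp_mul_exp_neg (LinearMap.toContinuousLinearMap D))
  inv_val := congrArg ContinuousLinearMap.toLinearMap
    (exp_neg_mul_exp (LinearMap.toContinuousLinearMap D))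

/-- `N⁺ = exp 𝔫⁺`. -/
def Nplus : Set GLJ := {n | ∃ D ∈ frakN, n = expGL D}

/-- `H(g) = ½ log(-(g P⁻|E₁)) Ã₃¹(1)`. -/
def iwasawaH (g : GLJ) : Module.End ℝ J1 :=
  (1 / 2 * Real.log (-jip (g.val Pminus) E₁)) • At₃ 1

/-- `n_I(g)`. -/
def iwasawaN (g : GLJ) : GLJ :=
  expGL
    (G₁ ((1 / 2 / jip (g.val Pminus) E₁) • ∑ i : Fin 8, jip (g.val (Qplus (e i))) E₁ • e i)
      + G₂ ((-(1 / 2) / jip (g.val Pminus) E₁) •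
          ∑ i : Fin 7, jip (g.val (F₃ (e i.succ))) E₁ • e i.succ))

/-- `k(g) = g n_I(g)⁻¹ exp(-H(g))`. -/
def iwasawaK (g : GLJ) : GLJ := g * (iwasawaN g)⁻¹ * expGL (-iwasawaH g)

end F4Iwasawa

end

open scoped Quaternion

noncomputable section

set_option linter.unusedSimpArgs false

namespace F4Iwasawa

open Octonion

/-! ### Octonion identities that stand in for associativity. -/

namespace Octonion

/-! Two facts prepare the ground. Automorphisms preserve the trace, hence the inner product
(`jip_map`), so `(gZ|E₁) = (Z|g⁻¹E₁)`. Since `σ` is a polynomial in multiplication by `E₁` whose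
`-1`-eigenspace is the Peirce ½-space, commuting with `σ` is the same as fixing `E₁` (`mem_K_iff`).

Existence. `k(g) ∈ K` means that `k(g)⁻¹` fixes `E₁`. A point `E` of the orbit of `E₁` has
horospherical coordinates `(Z|E)`, for `Z` among `P⁻`, `Q⁺(y)` and `F₃¹(q)` with `q` imaginary.
These `Z` are eigenvectors of `Ã₃¹(1)` of weights 2, 1, 0, on which `exp(-(𝒢₁(x) + 𝒢₂(p)))` only
adds vectors of higher weight. The parameters in `n_I(g)` make the coordinates of weights 1 and 0
vanish, and `H(g)` scales the coordinate of weight 2 to `-1`, which requires `(gP⁻|E₁) < 0`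
(`jip_Pminus_neg`). The resulting coordinates are those of `E₁`, and they determine it
(`map_E₁_eq_E₁`).

Uniqueness. `N⁺` fixes `P⁻`, `exp H` scales it and `K` fixes `E₁`, so `(gP⁻|E₁)` determines `H`. Two
decompositions then differ by an element of `K` that is the identity modulo higher weights. Since
`σ` negates weights, it is also the identity modulo lower weights, hence trivial
(`IsUnipotentRaising.eq_one_of_mem_K`). -/

theorem re_def (x : Octonion ℝ) : x.re = x.fst.re := rfl

theorem ip_eq_sum (x y : Octonion ℝ) : ip x y = x.fst.re * y.fst.re + x.fst.imI * y.fst.imI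
    + x.fst.imJ * y.fst.imJ + x.fst.imK * y.fst.imK + x.snd.re * y.snd.re
    + x.snd.imI * y.snd.imI + x.snd.imJ * y.snd.imJ + x.snd.imK * y.snd.imK := by
  simp [ip, conj, Octonion.re]; ring

theorem ip_comm (x y : Octonion ℝ) : ip x y = ip y x := by
  simp only [ip_eq_sum]; ring

@[simp] theorem ip_zero (x : Octonion ℝ) : ip x 0 = 0 := by
  simpa using ip_smul 0 x 0

@[simp] theorem zero_ip (x : Octonion ℝ) : ip 0 x = 0 := by
  simpa using smul_ip 0 0 x

@[simp] theorem ip_neg (x y : Octonion ℝ) : ip x (-y) = -ip x y := by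
  simpa using ip_smul (-1) x y

@[simp] theorem neg_ip (x y : Octonion ℝ) : ip (-x) y = -ip x y := by
  simpa using smul_ip (-1) x y

theorem ip_sub (x y z : Octonion ℝ) : ip x (y - z) = ip x y - ip x z := by
  rw [sub_eq_add_neg, ip_add, ip_neg, sub_eq_add_neg]

theorem sub_ip (x y z : Octonion ℝ) : ip (y - z) x = ip y x - ip z x := by
  rw [sub_eq_add_neg, add_ip, neg_ip, sub_eq_add_neg]

@[simp] theorem conj_zero : conj (0 : Octonion ℝ) = 0 := by
  simpa using conj_smul 0 (0 : Octonion ℝ)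

@[simp] theorem conj_one : conj (1 : Octonion ℝ) = 1 := by
  ext1 <;> simp [conj]

@[simp] theorem mul_one' (x : Octonion ℝ) : x * 1 = x := by
  simpa using mul_real 1 x

@[simp] theorem one_mul' (x : Octonion ℝ) : 1 * x = x := by
  simpa using real_mul 1 x

@[simp] theorem re_one : (1 : Octonion ℝ).re = 1 := rfl

@[simp] theorem re_zero : (0 : Octonion ℝ).re = 0 := rfl

theorem re_smul (r : ℝ) (x : Octonion ℝ) : (r • x).re = r * x.re := rfl

theorem re_add (x y : Octonion ℝ) : (x + y).re = x.re + y.re := rfl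

theorem re_neg (x : Octonion ℝ) : (-x).re = -x.re := rfl

theorem re_mul (x y : Octonion ℝ) : (x * y).re = ip x (conj y) := by
  rw [ip, conj_conj]

theorem ip_one (x : Octonion ℝ) : ip x 1 = x.re := by
  rw [ip, conj_one, mul_one']

theorem one_ip (x : Octonion ℝ) : ip 1 x = x.re := by
  rw [ip_comm, ip_one]

@[simp] theorem ip_conj_conj (x y : Octonion ℝ) : ip (conj x) (conj y) = ip x y := by
  simp [ip_eq_sum, conj]

/-- Multiplicativity of the norm. -/
theorem ip_mul_mul_self (x y : Octonion ℝ) : ip (x * y) (x * y) = ip x x * ip y y := by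
  simp [ip_eq_sum]; ring

theorem ip_self_nonneg (x : Octonion ℝ) : 0 ≤ ip x x := by
  rw [ip_eq_sum]; nlinarith

theorem re_sq_le_ip_self (x : Octonion ℝ) : x.re ^ 2 ≤ ip x x := by
  rw [ip_eq_sum, re_def]; nlinarith

theorem eq_zero_of_ip_self {x : Octonion ℝ} (h : ip x x = 0) : x = 0 := by
  rw [ip_eq_sum] at h
  ext
  · change x.fst.re = 0; nlinarith
  · change x.fst.imI = 0; nlinarith
  · change x.fst.imJ = 0; nlinarith
  · change x.fst.imK = 0; nlinarith
  · change x.snd.re = 0; nlinarith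
  · change x.snd.imI = 0; nlinarith
  · change x.snd.imJ = 0; nlinarith
  · change x.snd.imK = 0; nlinarith

theorem eq_zero_of_forall_ip {x : Octonion ℝ} (h : ∀ y, ip x y = 0) : x = 0 :=
  eq_zero_of_ip_self (h x)

theorem exists_ip_eq_zero (x : Octonion ℝ) : ∃ y : Octonion ℝ, ip x y = 0 ∧ ip y y ≠ 0 := by
  by_cases h : x.re = 0
  · exact ⟨1, by rw [ip_one, h], by simp [ip_one]⟩
  · refine ⟨mk (quat (-x.fst.imI) x.fst.re 0 0) (quat 0 0 0 0), ?_, ?_⟩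
    · simp [ip_eq_sum]; ring
    · rw [re_def] at h
      have := pow_pos (abs_pos.2 h) 2
      rw [sq_abs] at this
      simp [ip_eq_sum]
      nlinarith

theorem conj_eq_neg {p : Octonion ℝ} (hp : p.re = 0) : conj p = -p := by
  rw [re_def] at hp
  ext <;> simp [conj, hp]

/-- Left multiplication by `conj x` is the adjoint of left multiplication by `x`. -/
theorem mul_ip (x y z : Octonion ℝ) : ip (x * y) z = ip y (conj x * z) := by
  simp [ip_eq_sum, conj]; ring

theorem mul_ip' (x y z : Octonion ℝ) : ip (x * y) z = ip x (z * conj y) := by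
  simp [ip_eq_sum, conj]; ring

/-- Polarization of `ā(ac) = (a|a)c`. This and its mirror image replace associativity in the
verification of derivations. -/
theorem conj_mul_mul_add (a b c : Octonion ℝ) :
    conj a * (b * c) + conj b * (a * c) = (2 * ip a b) • c := by
  ext <;> simp [ip_eq_sum, conj] <;> ring

theorem mul_mul_conj_add (a b c : Octonion ℝ) :
    (c * a) * conj b + (c * b) * conj a = (2 * ip a b) • c := by
  ext <;> simp [ip_eq_sum, conj] <;> ring

theorem conj_eq_sub (x : Octonion ℝ) : conj x = (2 * x.re) • 1 - x := by
  have h := conj_mul_mul_add 1 x 1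
  simp only [conj_one, mul_one', one_mul', one_ip] at h
  rw [← h, add_sub_cancel_left]

/-- The linearized left alternative law; it follows from the composition identity because `ā` is
`-a` up to a real number. -/
theorem mul_mul_add_mul_mul (a b c : Octonion ℝ) :
    a * (b * c) + b * (a * c) = (a * b + b * a) * c := by
  have h₁ := conj_mul_mul_add a b c
  have h₂ := congrArg (· * c) (conj_mul_mul_add a b 1)
  simp only [conj_eq_sub, sub_mul, add_mul, smul_mul_left', one_mul', mul_one'] at h₁ h₂
  rw [add_mul]
  linear_combination (norm := module) h₂ - h₁

theorem mul_mul_add_mul_mul' (a b c : Octonion ℝ) :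
    (c * a) * b + (c * b) * a = c * (a * b + b * a) := by
  have h := congrArg conj (mul_mul_add_mul_mul (conj a) (conj b) (conj c))
  simp only [conj_add, conj_mul, conj_conj] at h
  rw [add_comm, h, add_comm (a * b)]

/-- Both sides are real parts of triple products: `Re(x(yz))` is invariant under cyclic
permutations. -/
theorem ip_conj_mul_cycle (x y z : Octonion ℝ) :
    ip x (conj (y * z)) = ip y (conj (z * x)) := by
  rw [conj_mul, ip_comm, mul_ip, conj_conj, ← ip_conj_conj, conj_conj]

end Octonion

/-! ### The explicit derivations of `𝒥¹`. -/

@[simp] theorem h1_fst_zero (a b c : ℝ) (x y z : Octonion ℝ) : (h1 a b c x y z).1 0 = a := rfl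
@[simp] theorem h1_fst_one (a b c : ℝ) (x y z : Octonion ℝ) : (h1 a b c x y z).1 1 = b := rfl
@[simp] theorem h1_fst_two (a b c : ℝ) (x y z : Octonion ℝ) : (h1 a b c x y z).1 2 = c := rfl
@[simp] theorem h1_snd_zero (a b c : ℝ) (x y z : Octonion ℝ) : (h1 a b c x y z).2 0 = x := rfl
@[simp] theorem h1_snd_one (a b c : ℝ) (x y z : Octonion ℝ) : (h1 a b c x y z).2 1 = y := rfl
@[simp] theorem h1_snd_two (a b c : ℝ) (x y z : Octonion ℝ) : (h1 a b c x y z).2 2 = z := rfl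

theorem J1.ext' {X Y : J1} (h₀ : X.1 0 = Y.1 0) (h₁ : X.1 1 = Y.1 1) (h₂ : X.1 2 = Y.1 2)
    (k₀ : X.2 0 = Y.2 0) (k₁ : X.2 1 = Y.2 1) (k₂ : X.2 2 = Y.2 2) : X = Y := by
  ext i : 2 <;> fin_cases i <;> assumption

theorem jmul_comm (X Y : J1) : jmul X Y = jmul Y X := by
  apply J1.ext' <;> simp only [jmul, h1_fst_zero, h1_fst_one, h1_fst_two, h1_snd_zero,
    h1_snd_one, h1_snd_two, ip_comm (X.2 _) (Y.2 _)]
  · ring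
  · ring
  · ring
  · module
  · module
  · module

/-- By polarization, the Leibniz rule need only be checked on squares, as the product is
commutative. -/
theorem mem_f4_of_sq {D : Module.End ℝ J1}
    (h : ∀ X : J1, D (jmul X X) = (2 : ℝ) • jmul (D X) X) : D ∈ f4 := by
  intro X Y
  have h₁ := h (X + Y)
  simp only [map_add, add_jmul, jmul_add, h X, h Y, jmul_comm (D Y) X, jmul_comm Y X] at h₁
  linear_combination (norm := module) (1 / 2 : ℝ) • h₁

theorem ip_conj_mul_conj (x y z : Octonion ℝ) :
    ip x (conj y * conj z) = ip (conj x * conj y) z := by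
  rw [← conj_mul, ip_conj_mul_cycle, conj_mul, ip_comm]

theorem ip_conj_mul_conj' (x y z : Octonion ℝ) :
    ip x (conj y * conj z) = ip (conj z * conj x) y := by
  rw [ip_conj_mul_conj, ip_comm, ip_conj_mul_conj]

/-- The diagonal entries reduce to the cyclicity of `Re(xyz)`, the octonion entries to the polarized
composition identities. The same holds for `At₂` and `At₃`. -/
theorem At₁_mem_f4 (a : Octonion ℝ) : At₁ a ∈ f4 := by
  refine mem_f4_of_sq fun X => ?_
  have t₁ := ip_conj_mul_conj a (X.2 2) (X.2 1)
  have t₂ := ip_conj_mul_conj' a (X.2 2) (X.2 1)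
  apply J1.ext' <;> simp only [At₁, LinearMap.coe_mk, AddHom.coe_mk, Prod.smul_fst, Prod.smul_snd,
    Pi.smul_apply, smul_eq_mul, jmul, h1_fst_zero, h1_fst_one, h1_fst_two, h1_snd_zero,
    h1_snd_one, h1_snd_two, ip_add, add_ip, ip_sub, sub_ip, ip_smul, smul_ip, ip_neg, neg_ip,
    conj_mul, conj_conj, conj_smul, conj_add, conj_sub, conj_neg, mul_smul_right',
    smul_mul_left', mul_add, add_mul, mul_sub, sub_mul, neg_mul, mul_neg]
  · linarith
  · linarith
  · linarith
  · linear_combination (norm := module) (-1 / 2 : ℝ) • conj_mul_mul_add (X.2 2) (X.2 2) a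
      + (1 / 2 : ℝ) • mul_mul_conj_add (X.2 1) (X.2 1) a
  · linear_combination (norm := module) (-1 : ℝ) • conj_mul_mul_add a (X.2 0) (X.2 1)
  · linear_combination (norm := module) mul_mul_conj_add a (X.2 0) (X.2 2)

theorem At₂_mem_f4 (a : Octonion ℝ) : At₂ a ∈ f4 := by
  refine mem_f4_of_sq fun X => ?_
  have t₁ := ip_conj_mul_conj a (X.2 0) (X.2 2)
  have t₂ := ip_conj_mul_conj' a (X.2 0) (X.2 2)
  apply J1.ext' <;> simp only [At₂, LinearMap.coe_mk, AddHom.coe_mk, Prod.smul_fst, Prod.smul_snd,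
    Pi.smul_apply, smul_eq_mul, jmul, h1_fst_zero, h1_fst_one, h1_fst_two, h1_snd_zero,
    h1_snd_one, h1_snd_two, ip_add, add_ip, ip_sub, sub_ip, ip_smul, smul_ip, ip_neg, neg_ip,
    conj_mul, conj_conj, conj_smul, conj_add, conj_sub, conj_neg, mul_smul_right',
    smul_mul_left', mul_add, add_mul, mul_sub, sub_mul, neg_mul, mul_neg]
  · linarith
  · linarith
  · linarith
  · linear_combination (norm := module) (-1 : ℝ) • mul_mul_conj_add a (X.2 1) (X.2 0)
  · linear_combination (norm := module) (1 / 2 : ℝ) • conj_mul_mul_add (X.2 0) (X.2 0) a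
      + (1 / 2 : ℝ) • mul_mul_conj_add (X.2 2) (X.2 2) a
  · linear_combination (norm := module) conj_mul_mul_add a (X.2 1) (X.2 2)

theorem At₃_mem_f4 (a : Octonion ℝ) : At₃ a ∈ f4 := by
  refine mem_f4_of_sq fun X => ?_
  have t₁ := ip_conj_mul_conj a (X.2 1) (X.2 0)
  have t₂ := ip_conj_mul_conj' a (X.2 1) (X.2 0)
  apply J1.ext' <;> simp only [At₃, LinearMap.coe_mk, AddHom.coe_mk, Prod.smul_fst, Prod.smul_snd,
    Pi.smul_apply, smul_eq_mul, jmul, h1_fst_zero, h1_fst_one, h1_fst_two, h1_snd_zero,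
    h1_snd_one, h1_snd_two, ip_add, add_ip, ip_sub, sub_ip, ip_smul, smul_ip, ip_neg, neg_ip,
    conj_mul, conj_conj, conj_smul, conj_add, conj_sub, conj_neg, mul_smul_right',
    smul_mul_left', mul_add, add_mul, mul_sub, sub_mul, neg_mul, mul_neg]
  · linarith
  · linarith
  · linarith
  · linear_combination (norm := module) conj_mul_mul_add a (X.2 2) (X.2 0)
  · linear_combination (norm := module) (-1 : ℝ) • mul_mul_conj_add a (X.2 2) (X.2 1)
  · linear_combination (norm := module) (-1 / 2 : ℝ) • conj_mul_mul_add (X.2 1) (X.2 1) a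
      - (1 / 2 : ℝ) • mul_mul_conj_add (X.2 0) (X.2 0) a

/-- Infinitesimal triality for `(L_p, R_p, -(L_p + R_p))`. Multiplications by an imaginary `p` are
skew (`q₁`, `q₂`), which settles the diagonal; the linearized alternative laws (`l`, `r`) settle the
rest. -/
theorem delta_mem_f4 {p : Octonion ℝ} (hp : p.re = 0) : delta p ∈ f4 := by
  refine mem_f4_of_sq fun X => ?_
  have q₁ : ∀ x, ip (p * x) x = 0 := fun x => by
    have h := mul_ip p x x
    rw [conj_eq_neg hp, neg_mul, ip_neg, ip_comm x] at h
    linarith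
  have q₂ : ∀ x, ip (x * p) x = 0 := fun x => by
    have h := mul_ip' x p x
    rw [conj_eq_neg hp, mul_neg, ip_neg, ip_comm x] at h
    linarith
  have l := fun x y => mul_mul_add_mul_mul p x y
  have r := fun x y => mul_mul_add_mul_mul' x p y
  simp only [add_mul, mul_add] at l r
  apply J1.ext' <;> simp only [delta, q₁, q₂, conj_eq_neg hp, LinearMap.coe_mk, AddHom.coe_mk,
    Prod.smul_fst, Prod.smul_snd,
    Pi.smul_apply, smul_eq_mul, jmul, h1_fst_zero, h1_fst_one, h1_fst_two, h1_snd_zero,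
    h1_snd_one, h1_snd_two, ip_add, add_ip, ip_sub, sub_ip, ip_smul, smul_ip, ip_neg, neg_ip,
    conj_mul, conj_conj, conj_smul, conj_add, conj_sub, conj_neg, mul_smul_right',
    smul_mul_left', mul_add, add_mul, mul_sub, sub_mul, neg_mul, mul_neg]
  · simp
  · simp
  · simp
  · linear_combination (norm := module) (-1 : ℝ) • l (conj (X.2 2)) (conj (X.2 1))
  · linear_combination (norm := module) r (conj (X.2 2)) (conj (X.2 0))
  · linear_combination (norm := module) (-1 : ℝ) • l (conj (X.2 1)) (conj (X.2 0))
      - r (conj (X.2 0)) (conj (X.2 1))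

/-! ### Explicit root vectors. -/

theorem G₁_apply (x : Octonion ℝ) (X : J1) : G₁ x X = h1 (-(2 * ip (conj x) (X.2 1)))
    (2 * ip x (X.2 0)) (2 * ip (conj x) (X.2 1) - 2 * ip x (X.2 0))
    ((X.1 2 - X.1 1) • x + conj (X.2 2) * x) (-(conj x * conj (X.2 2)) - (X.1 0 - X.1 2) • conj x)
    (conj (X.2 1) * conj x + x * conj (X.2 0)) := by
  apply J1.ext' <;> simp [G₁, At₁, At₂, conj_mul, conj_conj, conj_neg] <;> first
    | ring1
    | module

theorem G₂_apply (p : Octonion ℝ) (X : J1) : G₂ p X = h1 (2 * ip p (X.2 2))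
    (-(2 * ip p (X.2 2))) 0
    (-(conj p * conj (X.2 1)) - p * X.2 0) (-(conj (X.2 0) * conj p) - X.2 1 * p)
    (-(X.1 1 - X.1 0) • p + (p * X.2 2 + X.2 2 * p)) := by
  apply J1.ext' <;> simp [G₂, At₃, delta, conj_mul, conj_conj, conj_neg]
  module

theorem At₃_one_apply (X : J1) : At₃ 1 X = h1 (-(2 * (X.2 2).re)) (2 * (X.2 2).re) 0
    (conj (X.2 1)) (conj (X.2 0)) ((X.1 1 - X.1 0) • 1) := by
  apply J1.ext' <;> simp [At₃, one_ip]

theorem mem_rootSpace {c : ℝ} {D : Module.End ℝ J1} (hD : D ∈ f4)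
    (h : ∀ X, At₃ 1 (D X) - D (At₃ 1 X) = c • D X) : D ∈ rootSpace c := by
  refine ⟨hD, fun t => LinearMap.ext fun X => ?_⟩
  simp only [LinearMap.sub_apply, Module.End.mul_apply, LinearMap.smul_apply, map_smul]
  rw [← smul_sub, h, smul_smul, mul_comm]

/-- Here and for `G₂` only the inclusion is needed: uniqueness argues with weights, so it does not
matter whether these vectors exhaust the root spaces. -/
theorem G₁_mem_rootSpace (x : Octonion ℝ) : G₁ x ∈ rootSpace 1 := by
  refine mem_rootSpace (add_mem (At₁_mem_f4 _) (At₂_mem_f4 _)) fun X => ?_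
  have c₀ := ip_comm (conj (X.2 1)) x
  have c₁ : ip x (conj (X.2 1)) = ip (conj x) (X.2 1) := by rw [← ip_conj_conj, conj_conj]
  have c₂ := conj_eq_sub (X.2 2)
  have m₁ := mul_conj_add x (conj (X.2 1))
  rw [conj_conj, c₁] at m₁
  have m₀ := mul_conj_add x (X.2 0)
  apply J1.ext' <;> simp only [G₁_apply, At₃_one_apply, Prod.fst_sub, Prod.snd_sub,
    Prod.smul_fst, Prod.smul_snd, Pi.smul_apply, smul_eq_mul,
    Pi.sub_apply, one_smul, h1_fst_zero, h1_fst_one, h1_fst_two, h1_snd_zero,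
    h1_snd_one, h1_snd_two, re_add, re_mul, conj_conj, conj_mul, conj_add, conj_sub, conj_neg,
    conj_smul, conj_one, mul_smul_right', smul_mul_left', mul_one', one_mul', ip_conj_conj,
    c₀, c₁, c₂, sub_mul, mul_sub]
  · ring
  · ring
  · ring
  · module
  · module
  · linear_combination (norm := module) (-1 : ℝ) • m₀ - m₁

theorem G₂_mem_rootSpace {p : Octonion ℝ} (hp : p.re = 0) : G₂ p ∈ rootSpace 2 := by
  refine mem_rootSpace (sub_mem (At₃_mem_f4 _) (delta_mem_f4 hp)) fun X => ?_
  have c₁ : ip p (conj (X.2 2)) = -ip p (X.2 2) := by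
    rw [← ip_conj_conj, conj_conj, conj_eq_neg hp, neg_ip]
  have m := mul_conj_add p (X.2 2)
  rw [conj_eq_neg hp, conj_eq_sub, mul_sub, mul_smul_right', mul_one', mul_neg] at m
  apply J1.ext' <;> simp only [G₂_apply, At₃_one_apply, Prod.fst_sub, Prod.snd_sub,
    Prod.smul_fst, Prod.smul_snd, Pi.smul_apply, smul_eq_mul,
    Pi.sub_apply, h1_fst_zero, h1_fst_one, h1_fst_two, h1_snd_zero, neg_mul, mul_neg,
    h1_snd_one, h1_snd_two, conj_eq_neg hp, re_add, re_mul, re_smul, conj_conj, conj_mul,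
    conj_sub, conj_neg, mul_smul_right', smul_mul_left', mul_one', one_mul', hp, c₁, ip_neg,
    ip_smul, ip_one, ip_comm (X.2 2) p]
  · ring
  · ring
  · ring
  · module
  · module
  · linear_combination (norm := module) (2 : ℝ) • m

/-! ### Invariance of the trace -/

/-- The multiplication operators of the Jordan algebra. -/
def jmulL : J1 →ₗ[ℝ] Module.End ℝ J1 :=
  LinearMap.mk₂ ℝ jmul add_jmul smul_jmul jmul_add jmul_smul

@[simp] theorem jmulL_apply (X Y : J1) : jmulL X Y = jmul X Y := rfl

/-- The Leibniz rule says that multiplication by `DX` is the commutator of `D` with multiplication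
by `X`, and commutators have trace zero. -/
theorem trace_jmulL_derivation {D : Module.End ℝ J1} (hD : D ∈ f4) (X : J1) :
    LinearMap.trace ℝ J1 (jmulL (D X)) = 0 := by
  have h : jmulL (D X) = D * jmulL X - jmulL X * D := by
    refine LinearMap.ext fun Y => ?_
    simp [hD X Y]
  rw [h, map_sub, LinearMap.trace_mul_comm, sub_self]

/-- Modulo values of derivations every element is a multiple of `E₁`. Hence the trace of
multiplication by `X` is proportional to `tr X`, which makes `tr` invariant under automorphisms. -/
theorem eq_tr_smul_add (X : J1) : X = tr X • E₁ + At₃ 1 (F₃ (((X.1 1 + X.1 2) / 2) • 1))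
    + At₁ 1 (h1 0 0 0 ((-X.1 2 / 2) • 1) 0 0) + At₁ (X.2 0) (h1 0 0 1 0 0 0)
    + At₂ (X.2 1) E₁ + At₃ (X.2 2) (h1 0 1 0 0 0 0) := by
  apply J1.ext' <;> simp [tr, E₁, F₃, At₁, At₂, At₃, ip_smul, ip_one] <;> ring

theorem trace_jmulL_eq (X : J1) :
    LinearMap.trace ℝ J1 (jmulL X) = tr X * LinearMap.trace ℝ J1 (jmulL E₁) := by
  conv_lhs => rw [eq_tr_smul_add X]
  simp only [map_add, map_smul, smul_eq_mul, trace_jmulL_derivation (At₁_mem_f4 _),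
    trace_jmulL_derivation (At₂_mem_f4 _), trace_jmulL_derivation (At₃_mem_f4 _), add_zero]

theorem trace_jmulL_E₁_ne_zero : LinearMap.trace ℝ J1 (jmulL E₁) ≠ 0 := by
  -- The unit element acts as the identity, whose trace is the positive dimension of `𝒥¹`.
  have h : jmulL (h1 1 1 1 0 0 0) = 1 := by
    refine LinearMap.ext fun Y => ?_
    apply J1.ext' <;> simp [jmul] <;> module
  have h' := trace_jmulL_eq (h1 1 1 1 0 0 0)
  rw [h, LinearMap.trace_one] at h'
  intro h₀
  rw [h₀, mul_zero] at h'
  exact Module.finrank_pos.ne' (Nat.cast_eq_zero.1 h')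

theorem tr_map {g : GLJ} (hg : g ∈ F4) (X : J1) : tr (g.val X) = tr X := by
  have h : jmulL (g.val X) = g.val * jmulL X * (g⁻¹).val := by
    refine LinearMap.ext fun Y => ?_
    have hY : g.val ((g⁻¹).val Y) = Y := LinearMap.congr_fun g.val_inv Y
    simp only [jmulL_apply, Module.End.mul_apply]
    rw [hg, hY]
  have h' := trace_jmulL_eq (g.val X)
  rw [h, LinearMap.trace_conj, trace_jmulL_eq X] at h'
  exact (mul_right_cancel₀ trace_jmulL_E₁_ne_zero h').symm

theorem jip_map {g : GLJ} (hg : g ∈ F4) (X Y : J1) :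
    jip (g.val X) (g.val Y) = jip X Y := by
  rw [jip, ← hg, tr_map hg, jip]

theorem val_inv_apply (g : GLJ) (X : J1) : g.val ((g⁻¹).val X) = X :=
  LinearMap.congr_fun g.val_inv X

theorem inv_val_apply (g : GLJ) (X : J1) : (g⁻¹).val (g.val X) = X :=
  LinearMap.congr_fun g.inv_val X

theorem jip_map_left {g : GLJ} (hg : g ∈ F4) (X Y : J1) :
    jip (g.val X) Y = jip X ((g⁻¹).val Y) := by
  rw [← jip_map hg X, val_inv_apply]

theorem jip_eq (X Y : J1) : jip X Y = X.1 0 * Y.1 0 + X.1 1 * Y.1 1 + X.1 2 * Y.1 2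
    + 2 * ip (X.2 0) (Y.2 0) - 2 * ip (X.2 1) (Y.2 1) - 2 * ip (X.2 2) (Y.2 2) := by
  simp [jip, tr, jmul]; ring

theorem jip_E₁ (X : J1) : jip X E₁ = X.1 0 := by
  simp [jip_eq, E₁]

theorem jip_Qplus (y : Octonion ℝ) (X : J1) :
    jip (Qplus y) X = 2 * ip y (X.2 0 - conj (X.2 1)) := by
  have : ip (conj y) (X.2 1) = ip y (conj (X.2 1)) := by rw [← ip_conj_conj, conj_conj]
  simp [jip_eq, Qplus, ip_sub, this]; ring

theorem jip_F₃ (q : Octonion ℝ) (X : J1) : jip (F₃ q) X = -(2 * ip q (X.2 2)) := by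
  simp [jip_eq, F₃]

/-! ### The group `K` -/

/-- Multiplication by `E₁` is diagonalizable with eigenvalues 0, ½, 1, and `1 - 8t + 8t²` takes the
values 1, -1, 1 there. -/
theorem sigma_apply (X : J1) : sigma.val X =
    X - (8 : ℝ) • jmul E₁ X + (8 : ℝ) • jmul E₁ (jmul E₁ X) := by
  apply J1.ext' <;> simp [sigma, sigmaLin, jmul, E₁] <;> module

theorem E₁_sq : jmul E₁ E₁ = E₁ := by
  apply J1.ext' <;> simp [jmul, E₁]

theorem tr_E₁ : tr E₁ = 1 := by simp [tr, E₁]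

/-- The diagonal of the equation `E ∘ E = E` together with `tr E = 1`. -/
theorem mul_eq_of_idempotent {E : J1} (h : jmul E E = E) (ht : tr E = 1) :
    E.1 0 * E.1 1 = -ip (E.2 2) (E.2 2) ∧ E.1 0 * E.1 2 = -ip (E.2 1) (E.2 1) ∧
      E.1 1 * E.1 2 = ip (E.2 0) (E.2 0) := by
  have h₀ : E.1 0 * E.1 0 - ip (E.2 1) (E.2 1) - ip (E.2 2) (E.2 2) = E.1 0 :=
    congrArg (fun X : J1 => X.1 0) h
  have h₁ : E.1 1 * E.1 1 + ip (E.2 0) (E.2 0) - ip (E.2 2) (E.2 2) = E.1 1 :=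
    congrArg (fun X : J1 => X.1 1) h
  have h₂ : E.1 2 * E.1 2 + ip (E.2 0) (E.2 0) - ip (E.2 1) (E.2 1) = E.1 2 :=
    congrArg (fun X : J1 => X.1 2) h
  have h₃ : E.1 2 = 1 - E.1 0 - E.1 1 := by rw [← ht, tr]; ring
  rw [h₃] at h₂ ⊢
  refine ⟨?_, ?_, ?_⟩ <;> linarith

theorem commute_sigma_of_map_E₁ {k : GLJ} (hk : k ∈ F4) (h : k.val E₁ = E₁) (X : J1) :
    sigma.val (k.val X) = k.val (sigma.val X) := by
  simp only [sigma_apply, map_sub, map_add, map_smul, hk E₁, h]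

theorem mem_K_iff_commute {k : GLJ} :
    k ∈ K ↔ k ∈ F4 ∧ ∀ X, sigma.val (k.val X) = k.val (sigma.val X) := by
  change (k ∈ F4 ∧ sigma * k * sigma⁻¹ = k) ↔ _
  rw [mul_inv_eq_iff_eq_mul]
  refine and_congr_right fun _ => ⟨fun h X => ?_, fun h => ?_⟩
  · exact LinearMap.congr_fun (congrArg Units.val h) X
  · exact Units.ext (LinearMap.ext h)

theorem map_E₁_of_commute {k : GLJ} (hk : k ∈ F4)
    (h : ∀ X, sigma.val (k.val X) = k.val (sigma.val X)) : k.val E₁ = E₁ := by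
  have hE : jmul (k.val E₁) (k.val E₁) = k.val E₁ := by rw [← hk, E₁_sq]
  have ht : tr (k.val E₁) = 1 := by rw [tr_map hk, tr_E₁]
  have hhalf : ∀ X, sigma.val X = -X → jmul E₁ X = (1 / 2 : ℝ) • X := by
    intro X hX
    have h₀ : X.1 0 = -X.1 0 := congrArg (fun X : J1 => X.1 0) hX
    have h₁ : X.1 1 = -X.1 1 := congrArg (fun X : J1 => X.1 1) hX
    have h₂ : X.1 2 = -X.1 2 := congrArg (fun X : J1 => X.1 2) hX
    have k₀ : X.2 0 = -X.2 0 := congrArg (fun X : J1 => X.2 0) hX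
    have h₀' : X.1 0 = 0 := by linarith
    have h₁' : X.1 1 = 0 := by linarith
    have h₂' : X.1 2 = 0 := by linarith
    have k₀' : X.2 0 = 0 := by
      linear_combination (norm := module) (1 / 2 : ℝ) • k₀
    apply J1.ext' <;> simp [jmul, E₁, h₀', h₁', h₂', k₀']
  -- `k` preserves the `-1`-eigenspace of `σ`, so `kE₁` also acts on it by ½. Two test vectors then
  -- give the diagonal of `kE₁` and `x₁ = 0`; invariance under `σ` kills `x₂` and `x₃`.
  have hE' : ∀ Y, sigma.val Y = -Y → jmul (k.val E₁) Y = (1 / 2 : ℝ) • Y := by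
    intro Y hY
    have := hhalf ((k⁻¹).val Y) (by
      have := h ((k⁻¹).val Y)
      rw [val_inv_apply, hY] at this
      rw [← inv_val_apply k (sigma.val _), ← this, map_neg])
    have := congrArg k.val this
    rwa [hk, val_inv_apply, map_smul, val_inv_apply] at this
  have h₂ := hE' (h1 0 0 0 0 1 0) (by apply J1.ext' <;> simp [sigma, sigmaLin])
  have h₃ := hE' (h1 0 0 0 0 0 1) (by apply J1.ext' <;> simp [sigma, sigmaLin])
  have hs : sigma.val (k.val E₁) = k.val E₁ := by
    rw [h]
    congr 1
    apply J1.ext' <;> simp [sigma, sigmaLin, E₁]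
  generalize k.val E₁ = E at *
  have s₁ : -E.2 1 = E.2 1 := congrArg (fun X : J1 => X.2 1) hs
  have s₂ : -E.2 2 = E.2 2 := congrArg (fun X : J1 => X.2 2) hs
  have a₁ := congrArg (fun X : J1 => (X.2 1).re) h₂
  have a₂ := congrArg (fun X : J1 => (X.2 2).re) h₃
  have a₃ := congrArg (fun X : J1 => conj (X.2 1)) h₃
  simp [jmul, re_smul, conj_conj, conj_smul] at a₁ a₂ a₃
  rw [tr] at ht
  apply J1.ext' <;> simp only [E₁, h1_fst_zero, h1_fst_one, h1_fst_two, h1_snd_zero,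
    h1_snd_one, h1_snd_two]
  · linarith
  · linarith
  · linarith
  · exact a₃
  · linear_combination (norm := module) (-1 / 2 : ℝ) • s₁
  · linear_combination (norm := module) (-1 / 2 : ℝ) • s₂

/-- `K` is the stabilizer of `E₁`. -/
theorem mem_K_iff {k : GLJ} : k ∈ K ↔ k ∈ F4 ∧ k.val E₁ = E₁ := by
  rw [mem_K_iff_commute]
  exact and_congr_right fun hk => ⟨map_E₁_of_commute hk, commute_sigma_of_map_E₁ hk⟩

/-! ### The orbits of `E₁` and `P⁻` -/

/-- The Peirce `½`-space of an element of the orbit of `E₁` is negative definite. -/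
theorem tr_peirce_nonpos {g : GLJ} (hg : g ∈ F4) (W : J1) :
    tr (jmul (g.val E₁) (jmul W W)) ≤ tr (jmul (jmul (g.val E₁) W) (jmul (g.val E₁) W)) := by
  obtain ⟨V, rfl⟩ : ∃ V, g.val V = W := ⟨_, val_inv_apply g W⟩
  simp only [← hg _, tr_map hg]
  have h₁ := ip_self_nonneg (V.2 1)
  have h₂ := ip_self_nonneg (V.2 2)
  simp [tr, jmul, E₁, ip_smul, smul_ip]
  linarith

/-- This separates the orbit of `E₁` from other idempotents of trace one, such as `h¹(0,1,0;0,0,0)`;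
negativity of the Peirce ½-space makes the difference. -/
theorem one_le_map_E₁ {g : GLJ} (hg : g ∈ F4) : 1 ≤ (g.val E₁).1 0 := by
  have hE : jmul (g.val E₁) (g.val E₁) = g.val E₁ := by rw [← hg, E₁_sq]
  have ht : tr (g.val E₁) = 1 := by rw [tr_map hg, tr_E₁]
  have hW := tr_peirce_nonpos hg
  generalize g.val E₁ = E at *
  obtain ⟨h₂, h₁, -⟩ := mul_eq_of_idempotent hE ht
  obtain ⟨y, hy, hy'⟩ := exists_ip_eq_zero (E.2 0)
  have hpos := lt_of_le_of_ne (ip_self_nonneg y) hy'.symm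
  -- As `y` is orthogonal to `x₁`, the diagonal of `E ∘ W` vanishes. With `s = ξ₂ + ξ₃` the
  -- inequality becomes `(y|y) s ≤ (y|y) s / 2`, so `s ≤ 0` and `ξ₁ = 1 - s ≥ 1`.
  have h := hW (h1 0 0 0 y 0 0)
  simp [tr, jmul, hy, ip_smul, smul_ip, ip_mul_mul_self] at h
  rw [tr] at ht
  by_contra! hlt
  have e₁ : ip (E.2 1) (E.2 1) = -(E.1 0 * E.1 2) := by linarith
  have e₂ : ip (E.2 2) (E.2 2) = -(E.1 0 * E.1 1) := by linarith
  have e₀ : E.1 0 = 1 - E.1 1 - E.1 2 := by linarith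
  rw [e₁, e₂, e₀] at h
  nlinarith [mul_pos hpos (sub_pos.2 hlt)]

theorem jip_Pminus_neg {g : GLJ} (hg : g ∈ F4) : jip (g.val Pminus) E₁ < 0 := by
  have hne : jip (g.val Pminus) E₁ ≠ 0 := by
    -- `gP⁻` is a nonzero element of square zero; if its `ξ₁` vanished, the diagonal of its square
    -- would force every coordinate to vanish.
    have hP : jmul Pminus Pminus = 0 := by
      apply J1.ext' <;> simp [jmul, Pminus, ip_one]
    have hX : jmul (g.val Pminus) (g.val Pminus) = 0 := by rw [← hg, hP, map_zero]
    have hX0 : g.val Pminus ≠ 0 := by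
      intro h
      have := inv_val_apply g Pminus
      rw [h, map_zero] at this
      have := congrArg (fun X : J1 => X.1 1) this
      simp [Pminus] at this
    rw [jip_E₁]
    generalize g.val Pminus = X at *
    intro h
    have h₀ := congrArg (fun X : J1 => X.1 0) hX
    have h₁ := congrArg (fun X : J1 => X.1 1) hX
    have h₂ := congrArg (fun X : J1 => X.1 2) hX
    simp [jmul, h] at h₀ h₁ h₂
    have n₀ := ip_self_nonneg (X.2 0)
    have n₁ := ip_self_nonneg (X.2 1)
    have n₂ := ip_self_nonneg (X.2 2)
    apply hX0
    apply J1.ext'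
    · exact h
    · change X.1 1 = 0
      nlinarith
    · change X.1 2 = 0
      nlinarith
    · exact eq_zero_of_ip_self (by nlinarith)
    · exact eq_zero_of_ip_self (by nlinarith)
    · exact eq_zero_of_ip_self (by nlinarith)
  refine lt_of_le_of_ne ?_ hne
  rw [jip_map_left hg]
  have hg' := inv_mem hg
  have h1' := one_le_map_E₁ hg'
  have hE : jmul ((g⁻¹).val E₁) ((g⁻¹).val E₁) = (g⁻¹).val E₁ := by rw [← hg', E₁_sq]
  have ht : tr ((g⁻¹).val E₁) = 1 := by rw [tr_map hg', tr_E₁]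
  generalize (g⁻¹).val E₁ = E at *
  obtain ⟨h₂, -, -⟩ := mul_eq_of_idempotent hE ht
  have h₃ := re_sq_le_ip_self (E.2 2)
  simp [jip_eq, Pminus, one_ip]
  -- With `r = Re x₃`, `ξ₁ξ₂ = -(x₃|x₃) ≤ -r²` gives `ξ₁(P⁻|E) ≤ -(ξ₁ + r)²`, and `ξ₁ ≥ 1`.
  nlinarith [sq_nonneg (E.1 0 + (E.2 2).re)]

/-- The horospherical coordinates of an element of the orbit of `E₁` determine it. -/
theorem map_E₁_eq_E₁ {g : GLJ} (hg : g ∈ F4) (hP : jip Pminus (g.val E₁) = -1)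
    (hQ : ∀ y, jip (Qplus y) (g.val E₁) = 0)
    (hF : ∀ q : Octonion ℝ, q.re = 0 → jip (F₃ q) (g.val E₁) = 0) : g.val E₁ = E₁ := by
  have h1' := one_le_map_E₁ hg
  have hE : jmul (g.val E₁) (g.val E₁) = g.val E₁ := by rw [← hg, E₁_sq]
  have ht : tr (g.val E₁) = 1 := by rw [tr_map hg, tr_E₁]
  generalize g.val E₁ = E at *
  obtain ⟨h₂, h₁, h₀⟩ := mul_eq_of_idempotent hE ht
  have q : E.2 0 = conj (E.2 1) := by
    have : conj (E.2 1) - E.2 0 = 0 := by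
      refine eq_zero_of_forall_ip fun y => ?_
      have := hQ y
      rw [jip_Qplus, ip_comm, sub_ip] at this
      rw [sub_ip]
      linarith
    exact (sub_eq_zero.1 this).symm
  have v : E.2 2 = (E.2 2).re • 1 := by
    have hi : (E.2 2 - (E.2 2).re • 1).re = 0 := by
      rw [sub_eq_add_neg, re_add, re_neg, re_smul, re_one, mul_one, add_neg_cancel]
    have := hF _ hi
    have h' : ip (E.2 2 - (E.2 2).re • 1) 1 = 0 := by rw [ip_one, hi]
    simp [jip_eq, F₃] at this
    refine sub_eq_zero.1 (eq_zero_of_ip_self ?_)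
    rw [ip_sub, ip_smul, this, h']
    ring
  rw [q, ip_conj_conj] at h₀
  have hv : ip (E.2 2) (E.2 2) = (E.2 2).re * (E.2 2).re := by
    conv_lhs => rw [v]
    simp [ip_smul, smul_ip, ip_one]
  simp [jip_eq, Pminus, one_ip] at hP
  rw [tr] at ht
  have n₁ := ip_self_nonneg (E.2 1)
  -- Since `x₁` and `x₂` have equal norm, `ξ₃(ξ₁ + ξ₂) = 0`. If `ξ₁ + ξ₂ = 0`, then `ξ₃ = 1` and `ξ₁
  -- = -(x₂|x₂) ≤ 0`, contrary to `ξ₁ ≥ 1`.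
  have e₂ : E.1 2 = 0 := by
    have : E.1 2 * (E.1 0 + E.1 1) = 0 := by linarith
    rcases mul_eq_zero.1 this with h | h
    · exact h
    · nlinarith
  have ev : (E.2 2).re = 0 := by
    rw [hv] at h₂
    have : E.1 1 = 1 - E.1 0 := by linarith
    rw [this] at h₂ hP
    have : E.1 0 = 1 - (E.2 2).re := by linarith
    rw [this] at h₂
    linarith
  have e₁ : E.2 1 = 0 := eq_zero_of_ip_self (by rw [e₂] at h₁; linarith)
  apply J1.ext' <;> simp only [E₁, h1_fst_zero, h1_fst_one, h1_fst_two, h1_snd_zero,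
    h1_snd_one, h1_snd_two]
  · linarith
  · linarith
  · exact e₂
  · rw [q, e₁, conj_zero]
  · exact e₁
  · rw [v, ev, zero_smul]

/-! ### Exponentials -/

theorem hasSum_expGL (D : Module.End ℝ J1) (X : J1) :
    HasSum (fun n : ℕ => ((n.factorial : ℝ)⁻¹) • (D ^ n) X) ((expGL D).val X) := by
  have h := (ContinuousLinearMap.apply ℝ J1 X).hasSum
    (NormedSpace.exp_series_hasSum_exp' (𝕂 := ℝ) (LinearMap.toContinuousLinearMap D))
  refine Eq.subst (motive := fun f => HasSum f ((expGL D).val X)) (funext fun n => ?_) h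
  have hn : ∀ Y, (LinearMap.toContinuousLinearMap D ^ n) Y = (D ^ n) Y := by
    induction n with
    | zero => intro Y; rfl
    | succ n ih => intro Y; rw [pow_succ, pow_succ]; exact ih (D Y)
  change ((n.factorial : ℝ)⁻¹) • ((LinearMap.toContinuousLinearMap D ^ n) X) = _
  rw [hn]

theorem expGL_neg (D : Module.End ℝ J1) : expGL (-D) = (expGL D)⁻¹ := by
  refine Units.ext ?_
  change ((NormedSpace.exp (LinearMap.toContinuousLinearMap (-D)) : J1 →L[ℝ] J1) : J1 →ₗ[ℝ] J1) =
    (NormedSpace.exp (-LinearMap.toContinuousLinearMap D) : J1 →L[ℝ] J1)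
  rw [map_neg]

theorem expGL_apply_of_eigen {D : Module.End ℝ J1} {c : ℝ} {X : J1} (h : D X = c • X) :
    (expGL D).val X = Real.exp c • X := by
  have hn : ∀ n : ℕ, (D ^ n) X = c ^ n • X := by
    intro n
    induction n with
    | zero => simp
    | succ n ih => rw [pow_succ, Module.End.mul_apply, h, map_smul, ih, smul_smul, pow_succ']
  refine (hasSum_expGL D X).unique ?_
  simp only [hn, smul_smul]
  refine HasSum.smul_const ?_ X
  rw [Real.exp_eq_exp_ℝ]
  exact NormedSpace.exp_series_hasSum_exp' (𝕂 := ℝ) c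

theorem expGL_apply_of_cube {D : Module.End ℝ J1} {X : J1} (h : D (D (D X)) = 0) :
    (expGL D).val X = X + D X + (1 / 2 : ℝ) • D (D X) := by
  have hn : ∀ n : ℕ, n ∉ Finset.range 3 → ((n.factorial : ℝ)⁻¹) • (D ^ n) X = 0 := by
    intro n hn
    obtain ⟨m, rfl⟩ := Nat.exists_eq_add_of_le (not_lt.1 (fun h => hn (Finset.mem_range.2 h)))
    rw [add_comm, pow_add, Module.End.mul_apply]
    simp [pow_succ, h]
  refine (hasSum_expGL D X).unique ?_
  convert hasSum_sum_of_ne_finset_zero hn (L := .unconditional ℕ) using 1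
  simp [Finset.sum_range_succ, pow_succ, Nat.factorial]

theorem expGL_apply_sub_mem (U : Submodule ℝ J1) {D : Module.End ℝ J1} {X : J1}
    (h : ∀ n : ℕ, (D ^ (n + 1)) X ∈ U) : (expGL D).val X - X ∈ U := by
  have hs := ((hasSum_nat_add_iff' 1).2 (hasSum_expGL D X)).tendsto_sum_nat
  simp only [Finset.range_one, Finset.sum_singleton, Nat.factorial_zero, Nat.cast_one, inv_one,
    pow_zero, Module.End.one_apply, one_smul] at hs
  exact U.closed_of_finiteDimensional.mem_of_tendsto hs
    (Filter.Eventually.of_forall fun N => sum_mem fun n _ => U.smul_mem _ (h n))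

/-- The exponential of a derivation is an automorphism. -/
theorem expGL_mem_F4 {D : Module.End ℝ J1} (hD : D ∈ f4) : expGL D ∈ F4 := by
  intro X Y
  let T : J1 →L[ℝ] J1 := LinearMap.toContinuousLinearMap D
  let B : J1 →L[ℝ] J1 →L[ℝ] J1 := LinearMap.toContinuousBilinearMap jmulL
  have hB : ∀ u v, T (B u v) = B (T u) v + B u (T v) := hD
  -- By the Leibniz rule `φ` has derivative zero; `φ 1 = φ 0` is the claim up to applying `exp D`.
  let φ : ℝ → J1 := fun t => NormedSpace.exp (t • (-T))
    (B (NormedSpace.exp (t • T) X) (NormedSpace.exp (t • T) Y))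
  have hexp : ∀ (Z : J1) (t : ℝ), HasDerivAt (fun t : ℝ => NormedSpace.exp (t • T) Z)
      (T (NormedSpace.exp (t • T) Z)) t := fun Z t => by
    simpa using (hasDerivAt_exp_smul_const' (𝕂 := ℝ) T t).clm_apply (hasDerivAt_const t Z)
  have hφ : ∀ t, HasDerivAt φ 0 t := fun t => by
    have h := (hasDerivAt_exp_smul_const (𝕂 := ℝ) (-T) t).clm_apply
      (B.hasDerivAt_of_bilinear (fun _ => hexp X t) (fun _ => hexp Y t))
    refine h.congr_deriv ?_
    change NormedSpace.exp (t • (-T)) (-T (B _ _)) + _ = 0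
    rw [hB, map_neg, map_add, map_add]
    abel
  have h := is_const_of_deriv_eq_zero (fun t => (hφ t).differentiableAt)
    (fun t => (hφ t).deriv) 1 0
  have h' := congrArg (expGL D).val h
  simp only [φ, one_smul, zero_smul, NormedSpace.exp_zero, one_apply_eq_self] at h'
  exact h'.symm.trans (val_inv_apply (expGL D) _)

/-! ### Weights of `𝔞` and unipotent elements -/

/-- The sum of the weight spaces of `Ã₃¹(1)` with weights in `s`. -/
def weightSum (s : Set ℝ) : Submodule ℝ J1 := ⨆ c ∈ s, Module.End.eigenspace (At₃ 1) c

theorem mem_weightSum {s : Set ℝ} {c : ℝ} (hc : c ∈ s) {X : J1} (h : At₃ 1 X = c • X) :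
    X ∈ weightSum s :=
  Submodule.mem_iSup_of_mem c (Submodule.mem_iSup_of_mem hc (Module.End.mem_eigenspace_iff.2 h))

theorem weightSum_le_comap {s t : Set ℝ} {T : Module.End ℝ J1}
    (h : ∀ c ∈ s, ∀ X, At₃ 1 X = c • X → T X ∈ weightSum t) :
    weightSum s ≤ (weightSum t).comap T :=
  iSup₂_le fun c hc X hX => h c hc X (Module.End.mem_eigenspace_iff.1 hX)

theorem weightSum_mono {s t : Set ℝ} (h : s ⊆ t) : weightSum s ≤ weightSum t :=
  biSup_mono h

theorem disjoint_weightSum {s t : Set ℝ} (h : Disjoint s t) :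
    Disjoint (weightSum s) (weightSum t) :=
  (Module.End.eigenspaces_iSupIndep (At₃ 1)).disjoint_biSup_biSup h

theorem eq_zero_of_weight_gt {c : ℝ} (hc : 2 < c) {X : J1} (h : At₃ 1 X = c • X) : X = 0 := by
  have h₀ := congrArg (fun X : J1 => X.1 0) h
  have h₁ := congrArg (fun X : J1 => X.1 1) h
  have h₂ := congrArg (fun X : J1 => X.1 2) h
  have k₀ := congrArg (fun X : J1 => X.2 0) h
  have k₁ := congrArg (fun X : J1 => conj (X.2 1)) h
  have k₂ := congrArg (fun X : J1 => X.2 2) h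
  have r := congrArg (fun X : J1 => (X.2 2).re) h
  simp [At₃_one_apply, conj_conj, conj_smul, re_smul] at h₀ h₁ h₂ k₀ k₁ k₂ r
  have hc0 : c ≠ 0 := by linarith
  have hr : (X.2 2).re = 0 := by
    -- The eigenvalue equations couple `ξ₁`, `ξ₂` with `Re x₃`, giving `c² = 4`, and `x₁` with
    -- `x̄₂`, giving `c² = 1`; both fail for `c > 2`.
    have : (c * c - 4) * (X.2 2).re = 0 := by linear_combination h₀ - h₁ - c * r
    rcases mul_eq_zero.1 this with h | h
    · nlinarith
    · exact h
  have hx : X.2 0 = 0 := by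
    have : (c * c - 1) • X.2 0 = 0 := by
      rw [sub_smul, one_smul, mul_smul, ← k₀, ← k₁, sub_self]
    rcases smul_eq_zero.1 this with h | h
    · nlinarith
    · exact h
  rw [hr] at h₀ h₁ r
  have h₀' : X.1 0 = 0 := by simpa [hc0] using h₀
  have h₁' : X.1 1 = 0 := by simpa [hc0] using h₁
  apply J1.ext'
  · exact h₀'
  · exact h₁'
  · exact h₂.resolve_left hc0
  · exact hx
  · change X.2 1 = 0
    rw [← conj_conj (X.2 1), k₀, hx, smul_zero, conj_zero]
  · rw [h₀', h₁', sub_self, zero_smul] at k₂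
    exact (smul_eq_zero.1 k₂.symm).resolve_left hc0

theorem weightSum_Ioi_two : weightSum (Set.Ioi 2) = ⊥ :=
  le_bot_iff.1 (iSup₂_le fun _ hc _ hX =>
    (Submodule.mem_bot ℝ).2 (eq_zero_of_weight_gt hc (Module.End.mem_eigenspace_iff.1 hX)))

theorem At₃_one_Pminus : At₃ 1 Pminus = (2 : ℝ) • Pminus := by
  apply J1.ext' <;> simp [At₃_one_apply, Pminus]
  norm_num

theorem At₃_one_Qplus (y : Octonion ℝ) : At₃ 1 (Qplus y) = (1 : ℝ) • Qplus y := by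
  apply J1.ext' <;> simp [At₃_one_apply, Qplus, conj_conj]

theorem At₃_one_F₃ {q : Octonion ℝ} (hq : q.re = 0) : At₃ 1 (F₃ q) = (0 : ℝ) • F₃ q := by
  apply J1.ext' <;> simp [At₃_one_apply, F₃, hq]

theorem weightSum_univ : weightSum Set.univ = ⊤ := by
  refine eq_top_iff.2 fun X _ => ?_
  -- An explicit diagonalization: the summands have weights 2, -2, 0, 1, -1 in this order.
  have hX : X = ((X.2 2).re / 2 + (X.1 1 - X.1 0) / 4) • Pminus
      + ((X.2 2).re / 2 - (X.1 1 - X.1 0) / 4) • h1 1 (-1) 0 0 0 1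
      + h1 ((X.1 0 + X.1 1) / 2) ((X.1 0 + X.1 1) / 2) (X.1 2) 0 0 (X.2 2 - (X.2 2).re • 1)
      + Qplus ((1 / 2 : ℝ) • (X.2 0 + conj (X.2 1)))
      + h1 0 0 0 ((1 / 2 : ℝ) • (X.2 0 - conj (X.2 1)))
        ((1 / 2 : ℝ) • (X.2 1 - conj (X.2 0))) 0 := by
    apply J1.ext' <;> simp only [Pminus, Qplus, Prod.fst_add, Prod.snd_add, Pi.add_apply,
      Prod.smul_fst, Prod.smul_snd, Pi.smul_apply, smul_eq_mul, h1_fst_zero, h1_fst_one,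
      h1_fst_two, h1_snd_zero, h1_snd_one, h1_snd_two, conj_smul, conj_add, conj_conj] <;>
      first
      | ring1
      | module
  have hminus : At₃ 1 (h1 1 (-1) 0 0 0 1) = (-2 : ℝ) • h1 1 (-1) 0 0 0 1 := by
    apply J1.ext' <;> simp [At₃_one_apply]
    module
  rw [hX]
  refine add_mem (add_mem (add_mem (add_mem (Submodule.smul_mem _ _ ?_)
    (Submodule.smul_mem _ _ ?_)) ?_) ?_) ?_
  · exact mem_weightSum (Set.mem_univ _) At₃_one_Pminus
  · exact mem_weightSum (Set.mem_univ _) hminus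
  · refine mem_weightSum (Set.mem_univ 0) ?_
    apply J1.ext' <;> simp [At₃_one_apply, sub_eq_add_neg, re_add, re_neg, re_smul]
  · exact mem_weightSum (Set.mem_univ _) (At₃_one_Qplus _)
  · refine mem_weightSum (Set.mem_univ (-1)) ?_
    apply J1.ext' <;> simp [At₃_one_apply, conj_smul, conj_sub, conj_conj] <;> module

theorem frakN_apply_mem {D : Module.End ℝ J1} (hD : D ∈ frakN) {c : ℝ} {X : J1}
    (hX : At₃ 1 X = c • X) : D X ∈ weightSum (Set.Ioi c) := by
  have key : ∀ d : ℝ, 0 < d → ∀ D ∈ rootSpace d, D X ∈ weightSum (Set.Ioi c) := by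
    intro d hd D hD
    refine mem_weightSum (c := d + c) (by simpa using hd) ?_
    have h := LinearMap.congr_fun (hD.2 1) X
    simp only [one_smul, mul_one, LinearMap.sub_apply, Module.End.mul_apply, hX, map_smul,
      LinearMap.smul_apply] at h
    rw [add_smul, ← h, sub_add_cancel]
  obtain ⟨D₁, h₁, D₂, h₂, rfl⟩ := Submodule.mem_sup.1 hD
  exact add_mem (key 1 one_pos D₁ h₁) (key 2 two_pos D₂ h₂)

/-- `m` is unipotent and raises the weights of `Ã₃¹(1)`. -/
def IsUnipotentRaising (m : GLJ) : Prop :=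
  ∀ (c : ℝ) (X : J1), At₃ 1 X = c • X → m.val X - X ∈ weightSum (Set.Ioi c)

theorem expGL_isUnipotentRaising {D : Module.End ℝ J1} (hD : D ∈ frakN) :
    IsUnipotentRaising (expGL D) := by
  intro c X hX
  refine expGL_apply_sub_mem _ fun n => ?_
  have hD' : weightSum (Set.Ioi c) ≤ (weightSum (Set.Ioi c)).comap D :=
    weightSum_le_comap fun d hd Y hY =>
      weightSum_mono (Set.Ioi_subset_Ioi (le_of_lt hd)) (frakN_apply_mem hD hY)
  induction n with
  | zero => simpa using frakN_apply_mem hD hX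
  | succ n ih => rw [pow_succ', Module.End.mul_apply]; exact hD' ih

/-- Unipotent raising elements are visibly closed under products, so uniqueness does not need `N⁺`
to be shown to be a group. -/
theorem IsUnipotentRaising.mul {m m' : GLJ} (h : IsUnipotentRaising m)
    (h' : IsUnipotentRaising m') : IsUnipotentRaising (m * m') := by
  intro c X hX
  have hm : weightSum (Set.Ioi c) ≤ (weightSum (Set.Ioi c)).comap m.val :=
    weightSum_le_comap fun d hd Y hY => by
      rw [← sub_add_cancel (m.val Y) Y]
      exact add_mem (weightSum_mono (Set.Ioi_subset_Ioi (le_of_lt hd)) (h d Y hY))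
        (mem_weightSum hd hY)
  have e : (m * m').val X - X = m.val (m'.val X - X) + (m.val X - X) := by
    rw [map_sub, sub_add_sub_cancel]
    rfl
  rw [e]
  exact add_mem (hm (h' c X hX)) (h c X hX)

theorem expGL_smul_apply {t c : ℝ} {X : J1} (h : At₃ 1 X = c • X) :
    (expGL (t • At₃ 1)).val X = Real.exp (t * c) • X :=
  expGL_apply_of_eigen (by rw [LinearMap.smul_apply, h, smul_smul])

theorem IsUnipotentRaising.conj {m : GLJ} (h : IsUnipotentRaising m) (t : ℝ) :
    IsUnipotentRaising (expGL (t • At₃ 1) * m * (expGL (t • At₃ 1))⁻¹) := by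
  intro c X hX
  have ha : weightSum (Set.Ioi c) ≤ (weightSum (Set.Ioi c)).comap (expGL (t • At₃ 1)).val :=
    weightSum_le_comap fun d hd Y hY => by
      rw [expGL_smul_apply hY]
      exact Submodule.smul_mem _ _ (mem_weightSum hd hY)
  have hi : ((expGL (t • At₃ 1))⁻¹).val X = Real.exp (-t * c) • X := by
    have hneg : -(t • At₃ 1) = (-t) • At₃ 1 := (neg_smul t (At₃ 1)).symm
    rw [← expGL_neg, hneg, expGL_smul_apply hX]
  have e : (expGL (t • At₃ 1) * m * (expGL (t • At₃ 1))⁻¹).val X - X =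
      Real.exp (-t * c) • (expGL (t • At₃ 1)).val (m.val X - X) := by
    change (expGL (t • At₃ 1)).val (m.val (((expGL (t • At₃ 1))⁻¹).val X)) - X = _
    rw [hi, map_smul, map_smul, map_sub, smul_sub, expGL_smul_apply hX, smul_smul,
      ← Real.exp_add, neg_mul, neg_add_cancel, Real.exp_zero, one_smul]
  rw [e]
  exact Submodule.smul_mem _ _ (ha (h c X hX))

theorem sigma_sigma (X : J1) : sigma.val (sigma.val X) = X :=
  LinearMap.congr_fun sigmaLin_mul_self X

theorem At₃_one_sigma (X : J1) : At₃ 1 (sigma.val X) = -sigma.val (At₃ 1 X) := by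
  apply J1.ext' <;> simp [At₃_one_apply, sigma, sigmaLin, re_neg, conj_neg]

theorem weight_sigma {c : ℝ} {X : J1} (h : At₃ 1 X = c • X) :
    At₃ 1 (sigma.val X) = (-c) • sigma.val X := by
  rw [At₃_one_sigma, h, map_smul, neg_smul]

/-- An element of `K` that is unipotent and raises the weights is trivial. -/
theorem IsUnipotentRaising.eq_one_of_mem_K {m : GLJ} (h : IsUnipotentRaising m) (hm : m ∈ K) :
    m = 1 := by
  have hσ := (mem_K_iff_commute.1 hm).2
  have hfix : ∀ (c : ℝ) (X : J1), At₃ 1 X = c • X → m.val X - X = 0 := by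
    intro c X hX
    have h₁ := h c X hX
    -- `σX` has weight `-c`, so `m` changes it by weights above `-c`; applying `σ`, which commutes
    -- with `m`, `mX - X` has weights below `c` as well as above.
    have h₂ := h _ _ (weight_sigma hX)
    have hle : weightSum (Set.Ioi (-c)) ≤ (weightSum (Set.Iio c)).comap sigma.val :=
      weightSum_le_comap fun d hd Y hY => by
        have hd' : -d ∈ Set.Iio c := by
          rw [Set.mem_Ioi] at hd
          rw [Set.mem_Iio]
          linarith
        exact mem_weightSum hd' (weight_sigma hY)
    have h₃ : sigma.val (m.val (sigma.val X) - sigma.val X) ∈ weightSum (Set.Iio c) := hle h₂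
    rw [map_sub, hσ, sigma_sigma] at h₃
    have hd : Disjoint (Set.Ioi c) (Set.Iio c) :=
      Set.disjoint_left.2 fun _ h h' => lt_asymm (Set.mem_Ioi.1 h) (Set.mem_Iio.1 h')
    exact Submodule.disjoint_def.1 (disjoint_weightSum hd) _ h₁ h₃
  refine Units.ext (LinearMap.ext fun X => ?_)
  have hX : X ∈ weightSum Set.univ := by rw [weightSum_univ]; trivial
  have hle : weightSum Set.univ ≤ LinearMap.ker (m.val - 1) :=
    iSup₂_le fun c _ Y hY => LinearMap.mem_ker.2 (hfix c Y (Module.End.mem_eigenspace_iff.1 hY))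
  exact sub_eq_zero.1 (LinearMap.mem_ker.1 (hle hX))

/-! ### The action of the explicit elements of `𝔫⁺` -/

theorem G₁_Pminus (x : Octonion ℝ) : G₁ x Pminus = 0 := by
  rw [G₁_apply]
  apply J1.ext' <;> simp [Pminus]

theorem G₂_Pminus {p : Octonion ℝ} (hp : p.re = 0) : G₂ p Pminus = 0 := by
  rw [G₂_apply]
  apply J1.ext' <;> simp [Pminus, ip_one, hp]
  module

theorem G₁_Qplus (x y : Octonion ℝ) : G₁ x (Qplus y) = (2 * ip x y) • Pminus := by
  rw [G₁_apply]
  apply J1.ext' <;> simp [Pminus, Qplus, conj_conj]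
  rw [add_comm, mul_conj_add]

theorem G₂_Qplus {p : Octonion ℝ} (hp : p.re = 0) (y : Octonion ℝ) : G₂ p (Qplus y) = 0 := by
  rw [G₂_apply]
  apply J1.ext' <;> simp [Qplus, conj_conj, conj_eq_neg hp]

theorem G₁_F₃ (x : Octonion ℝ) {q : Octonion ℝ} (hq : q.re = 0) :
    G₁ x (F₃ q) = Qplus (-(q * x)) := by
  rw [G₁_apply]
  apply J1.ext' <;> simp [F₃, Qplus, conj_conj, conj_eq_neg hq, conj_neg, conj_mul]

theorem G₂_F₃ (p : Octonion ℝ) {q : Octonion ℝ} (hp : p.re = 0) (hq : q.re = 0) :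
    G₂ p (F₃ q) = (-(2 * ip p q)) • Pminus := by
  have m := mul_conj_add p q
  rw [conj_eq_neg hp, conj_eq_neg hq, mul_neg, mul_neg] at m
  rw [G₂_apply]
  apply J1.ext' <;> simp [F₃, Pminus]
  rw [← m]
  abel

theorem ip_self_mul_of_re_eq_zero (x : Octonion ℝ) {q : Octonion ℝ} (hq : q.re = 0) :
    ip x (q * x) = 0 := by
  have h := mul_ip q x x
  rw [conj_eq_neg hq, neg_mul, ip_neg, ip_comm] at h
  linarith

theorem G₁_add_G₂_mem_frakN (x : Octonion ℝ) {p : Octonion ℝ} (hp : p.re = 0) :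
    G₁ x + G₂ p ∈ frakN :=
  add_mem (Submodule.mem_sup_left (G₁_mem_rootSpace x))
    (Submodule.mem_sup_right (G₂_mem_rootSpace hp))

theorem expGL_neg_Pminus (x : Octonion ℝ) {p : Octonion ℝ} (hp : p.re = 0) :
    (expGL (-(G₁ x + G₂ p))).val Pminus = Pminus := by
  have h : (-(G₁ x + G₂ p)) Pminus = (0 : ℝ) • Pminus := by
    simp [G₁_Pminus, G₂_Pminus hp]
  rw [expGL_apply_of_eigen h, Real.exp_zero, one_smul]

theorem expGL_neg_Qplus (x : Octonion ℝ) {p : Octonion ℝ} (hp : p.re = 0)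
    (y : Octonion ℝ) :
    (expGL (-(G₁ x + G₂ p))).val (Qplus y) = Qplus y - (2 * ip x y) • Pminus := by
  have h : (-(G₁ x + G₂ p)) (Qplus y) = -((2 * ip x y) • Pminus) := by
    simp [G₁_Qplus, G₂_Qplus hp]
  have h' : (-(G₁ x + G₂ p)) Pminus = 0 := by simp [G₁_Pminus, G₂_Pminus hp]
  rw [expGL_apply_of_cube] <;> simp only [h, h', map_neg, map_smul, smul_zero, neg_zero, map_zero]
  module

/-- The quadratic term of the exponential would be a multiple of `(x|qx) P⁻`, which vanishes because
left multiplication by an imaginary `q` is skew. -/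
theorem expGL_neg_F₃ (x : Octonion ℝ) {p : Octonion ℝ} (hp : p.re = 0)
    {q : Octonion ℝ} (hq : q.re = 0) :
    (expGL (-(G₁ x + G₂ p))).val (F₃ q) =
      F₃ q - Qplus (-(q * x)) + (2 * ip p q) • Pminus := by
  have h : (-(G₁ x + G₂ p)) (F₃ q) = -Qplus (-(q * x)) + (2 * ip p q) • Pminus := by
    simp [G₁_F₃ x hq, G₂_F₃ p hp hq]
    abel
  have h' : (-(G₁ x + G₂ p)) Pminus = 0 := by simp [G₁_Pminus, G₂_Pminus hp]
  have h'' : (-(G₁ x + G₂ p)) (Qplus (-(q * x))) = 0 := by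
    simp [G₁_Qplus, G₂_Qplus hp, ip_self_mul_of_re_eq_zero x hq]
  rw [expGL_apply_of_cube] <;>
    simp only [h, h', h'', map_add, map_neg, map_smul, smul_zero, neg_zero, map_zero, add_zero]
  module

/-! ### The explicit factors -/

theorem sum_ip_smul_e (w : Octonion ℝ) : ∑ i : Fin 8, ip (e i) w • e i = w := by
  rw [Fin.sum_univ_eight]
  have hz : (0 : ℍ[ℝ]) = quat 0 0 0 0 := by ext <;> rfl
  ext <;> simp [e, ip_eq_sum, hz]

theorem sum_ip_smul_e_succ (w : Octonion ℝ) :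
    ∑ i : Fin 7, ip (e i.succ) w • e i.succ = w - w.re • 1 := by
  have h := sum_ip_smul_e w
  have h0 : e 0 = 1 := by ext <;> rfl
  rw [Fin.sum_univ_succ, h0, one_ip] at h
  exact eq_sub_of_add_eq' h

/-- The factor `n_I(g)` in terms of the element `g⁻¹ E₁`. -/
theorem iwasawaN_eq {g : GLJ} (hg : g ∈ F4) : iwasawaN g =
    expGL (G₁ ((jip (g.val Pminus) E₁)⁻¹ • (((g⁻¹).val E₁).2 0 - conj (((g⁻¹).val E₁).2 1)))
      + G₂ ((jip (g.val Pminus) E₁)⁻¹ •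
        (((g⁻¹).val E₁).2 2 - (((g⁻¹).val E₁).2 2).re • 1))) := by
  rw [iwasawaN]
  -- Pairing with `Q⁺` yields a factor 2 and pairing with `F₃¹` a factor -2; the coefficients ½ and
  -- -½ in `iwasawaN` cancel them.
  simp only [jip_map_left hg (Qplus _), jip_map_left hg (F₃ _), jip_Qplus, jip_F₃, mul_smul,
    neg_smul, Finset.sum_neg_distrib, ← Finset.smul_sum, sum_ip_smul_e, sum_ip_smul_e_succ]
  congr 3
  · rw [smul_smul]
    congr 1
    ring
  · rw [← neg_smul, smul_smul]
    congr 1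
    ring

theorem re_sub_re_smul_one (w : Octonion ℝ) (r : ℝ) : (r • (w - w.re • 1)).re = 0 := by
  rw [re_smul, sub_eq_add_neg, re_add, re_neg, re_smul, re_one, mul_one, add_neg_cancel, mul_zero]

theorem iwasawaN_mem {g : GLJ} (hg : g ∈ F4) : iwasawaN g ∈ Nplus :=
  ⟨_, G₁_add_G₂_mem_frakN _ (re_sub_re_smul_one _ _), iwasawaN_eq hg⟩

theorem frakN_le_f4 : frakN ≤ f4 := sup_le (fun _ h => h.1) (fun _ h => h.1)

theorem Nplus_subset_F4 {n : GLJ} (hn : n ∈ Nplus) : n ∈ F4 := by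
  obtain ⟨D, hD, rfl⟩ := hn
  exact expGL_mem_F4 (frakN_le_f4 hD)

theorem iwasawaH_mem (g : GLJ) : iwasawaH g ∈ frakA :=
  Submodule.smul_mem _ _ (Submodule.mem_span_singleton_self _)

theorem frakA_le_f4 : frakA ≤ f4 :=
  (Submodule.span_singleton_le_iff_mem _ _).2 (At₃_mem_f4 1)

theorem iwasawaK_mem_F4 {g : GLJ} (hg : g ∈ F4) : iwasawaK g ∈ F4 :=
  mul_mem (mul_mem hg (inv_mem (Nplus_subset_F4 (iwasawaN_mem hg))))
    (expGL_mem_F4 (neg_mem (frakA_le_f4 (iwasawaH_mem g))))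

theorem expGL_neg_iwasawaH_apply (g : GLJ) {c : ℝ} {X : J1} (h : At₃ 1 X = c • X) :
    (expGL (-iwasawaH g)).val X =
      Real.exp (-(1 / 2 * Real.log (-jip (g.val Pminus) E₁)) * c) • X := by
  have hneg : -iwasawaH g = (-(1 / 2 * Real.log (-jip (g.val Pminus) E₁))) • At₃ 1 :=
    (neg_smul _ (At₃ 1)).symm
  rw [hneg, expGL_smul_apply h]

theorem jip_add_left (X Y Z : J1) : jip (X + Y) Z = jip X Z + jip Y Z := by
  simp [jip, add_jmul, tr]; ring

theorem jip_smul_left (r : ℝ) (X Z : J1) : jip (r • X) Z = r * jip X Z := by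
  simp [jip, smul_jmul, tr]; ring

theorem jip_sub_left (X Y Z : J1) : jip (X - Y) Z = jip X Z - jip Y Z := by
  have h := jip_add_left (X - Y) Y Z
  rw [sub_add_cancel] at h
  linarith

theorem iwasawaK_mem {g : GLJ} (hg : g ∈ F4) : iwasawaK g ∈ K := by
  have hk := iwasawaK_mem_F4 hg
  refine mem_K_iff.2 ⟨hk, ?_⟩
  have hα := jip_Pminus_neg hg
  have hk' := inv_mem hk
  -- The horospherical coordinates of `k(g)⁻¹E₁` are those of `g⁻¹E₁`, with `n_I(g)⁻¹ exp(-H(g))`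
  -- moved onto the test vector.
  have key : ∀ Z, jip Z (((iwasawaK g)⁻¹).val E₁) =
      jip ((iwasawaN g)⁻¹.val ((expGL (-iwasawaH g)).val Z)) ((g⁻¹).val E₁) := fun Z => by
    rw [← jip_map_left hk, ← jip_map_left hg]
    rfl
  have hαE := jip_map_left hg Pminus E₁
  rw [iwasawaN_eq hg] at key
  rw [← expGL_neg] at key
  obtain ⟨α, hα'⟩ : ∃ α, α = jip (g.val Pminus) E₁ := ⟨_, rfl⟩
  obtain ⟨E, hE'⟩ : ∃ E, E = (g⁻¹).val E₁ := ⟨_, rfl⟩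
  rw [← hα', ← hE'] at key hαE
  rw [← hα'] at hα
  have hα0 : α ≠ 0 := hα.ne
  have hp := re_sub_re_smul_one (E.2 2) α⁻¹
  have hfix : ((iwasawaK g)⁻¹).val E₁ = E₁ := by
    refine map_E₁_eq_E₁ hk' ?_ (fun y => ?_) (fun q hq => ?_)
    · rw [key, expGL_neg_iwasawaH_apply g At₃_one_Pminus, map_smul, expGL_neg_Pminus _ hp,
        jip_smul_left, ← hαE, ← hα']
      have : -(1 / 2 * Real.log (-α)) * 2 = -Real.log (-α) := by ring
      rw [this, Real.exp_neg, Real.exp_log (neg_pos.2 hα), inv_neg, neg_mul,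
        inv_mul_cancel₀ hα0]
    · rw [key, expGL_neg_iwasawaH_apply g (At₃_one_Qplus y), map_smul, expGL_neg_Qplus _ hp,
        jip_smul_left, jip_sub_left, jip_smul_left, ← hαE, jip_Qplus, smul_ip, ip_comm y]
      field_simp
      ring
    · rw [key, expGL_neg_iwasawaH_apply g (At₃_one_F₃ hq), mul_zero, Real.exp_zero, one_smul,
        expGL_neg_F₃ _ hp hq, jip_add_left, jip_sub_left, jip_smul_left, ← hαE, jip_Qplus,
        jip_F₃, neg_ip, ip_comm _ (E.2 0 - conj (E.2 1)), mul_smul_right', ip_smul,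
        ip_self_mul_of_re_eq_zero _ hq, smul_ip, sub_ip, smul_ip, one_ip, hq, ip_comm q]
      field_simp
      ring
  conv_lhs => rw [← hfix]
  exact val_inv_apply _ _

theorem iwasawa_decomposition (g : GLJ) :
    g = iwasawaK g * expGL (iwasawaH g) * iwasawaN g := by
  rw [iwasawaK, expGL_neg]
  group

/-! ### Uniqueness of the factors. -/

theorem Nplus_apply_Pminus {n : GLJ} (hn : n ∈ Nplus) : n.val Pminus = Pminus := by
  obtain ⟨D, hD, rfl⟩ := hn
  have h := expGL_isUnipotentRaising hD 2 Pminus At₃_one_Pminus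
  rw [weightSum_Ioi_two, Submodule.mem_bot] at h
  exact sub_eq_zero.1 h

theorem iwasawaH_unique {g k n : GLJ} {H : Module.End ℝ J1} (hk : k ∈ K) (hH : H ∈ frakA)
    (hn : n ∈ Nplus) (h : g = k * expGL H * n) : H = iwasawaH g := by
  obtain ⟨t, rfl⟩ := Submodule.mem_span_singleton.1 hH
  obtain ⟨hkF, hkE⟩ := mem_K_iff.1 hk
  have hP : g.val Pminus = Real.exp (t * 2) • k.val Pminus := by
    rw [h]
    change k.val ((expGL (t • At₃ 1)).val (n.val Pminus)) = _
    rw [Nplus_apply_Pminus hn, expGL_smul_apply At₃_one_Pminus, map_smul]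
  have hα : jip (g.val Pminus) E₁ = -Real.exp (t * 2) := by
    rw [hP, jip_smul_left]
    nth_rewrite 1 [← hkE]
    rw [jip_map hkF, jip_E₁]
    simp [Pminus]
  rw [iwasawaH, hα, neg_neg, Real.log_exp]
  congr 1
  ring

theorem iwasawa_unique {g k n : GLJ} {H : Module.End ℝ J1} (hg : g ∈ F4) (hk : k ∈ K)
    (hH : H ∈ frakA) (hn : n ∈ Nplus) (h : g = k * expGL H * n) :
    k = iwasawaK g ∧ H = iwasawaH g ∧ n = iwasawaN g := by
  have hH' := iwasawaH_unique hk hH hn h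
  have h₀ := iwasawa_decomposition g
  rw [← hH'] at h₀
  -- With the same `H` in both decompositions, the quotient of the `K`-factors is a conjugate by
  -- `exp H` of a unipotent raising element, so it is itself unipotent raising.
  have hm : (iwasawaK g)⁻¹ * k = expGL H * (iwasawaN g * n⁻¹) * (expGL H)⁻¹ := by
    have e : iwasawaK g * expGL H * iwasawaN g = k * expGL H * n := h₀.symm.trans h
    have e' : k = iwasawaK g * expGL H * iwasawaN g * n⁻¹ * (expGL H)⁻¹ := by
      rw [e]; group
    rw [e']; group
  have hu : IsUnipotentRaising (iwasawaN g * n⁻¹) := by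
    obtain ⟨D, hD, hDg⟩ := iwasawaN_mem hg
    obtain ⟨D', hD', rfl⟩ := hn
    rw [hDg, ← expGL_neg]
    exact (expGL_isUnipotentRaising hD).mul (expGL_isUnipotentRaising (neg_mem hD'))
  have hone : (iwasawaK g)⁻¹ * k = 1 := by
    refine IsUnipotentRaising.eq_one_of_mem_K ?_ (mul_mem (inv_mem (iwasawaK_mem hg)) hk)
    rw [hm]
    obtain ⟨t, rfl⟩ := Submodule.mem_span_singleton.1 hH
    exact hu.conj t
  have hkk : k = iwasawaK g := (inv_mul_eq_one.1 hone).symm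
  refine ⟨hkk, hH', ?_⟩
  rw [hkk] at h
  exact mul_left_cancel (h.symm.trans h₀)

end F4Iwasawa

end

open F4Iwasawa in
theorem theorem9p4 :
    (∀ k : GLJ, k ∈ K ↔ k ∈ F4 ∧ k.val E₁ = E₁) ∧
    ∀ g ∈ F4,
      jip (g.val Pminus) E₁ < 0 ∧
      iwasawaK g ∈ K ∧ iwasawaH g ∈ frakA ∧ iwasawaN g ∈ Nplus ∧
      g = iwasawaK g * expGL (iwasawaH g) * iwasawaN g ∧
      ∀ k ∈ K, ∀ H ∈ frakA, ∀ n ∈ Nplus, g = k * expGL H * n →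
        k = iwasawaK g ∧ H = iwasawaH g ∧ n = iwasawaN g :=
  ⟨fun _ => mem_K_iff, fun g hg => ⟨jip_Pminus_neg hg, iwasawaK_mem hg, iwasawaH_mem g,
    iwasawaN_mem hg, iwasawa_decomposition g, fun _ hk _ hH _ hn h =>
      iwasawa_unique hg hk hH hn h⟩⟩
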